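/- For every $n\ge 1$ let $X_{1},\dots,X_{n}$ (a triangular array, $X_i=X_{n,i}$) be independent real random variables whose laws $P_{n,1},\dots,P_{n,n}$ are absolutely continuous with respect to Lebesgue measure; the laws may differ from each other and may change with $n$. Put $$U_n^{\rm Ken}=\frac{1}{n(n-1)}\sum_{i\ne j}\mathbf 1(j<i)\,\mathbf 1(X_j>X_i),\qquad U_n^{\rm AP}=\frac{1}{n(n-1)}\sum_{i\ne j}\frac{n\,\mathbf 1(j<i)}{i-1}\,\mathbf 1(X_j>X_i)$$ (with $0/0:=0$); these are the rescaled Kendall's tau $(\tau^{\rm Ken}+1)/4$ and the rescaled average-precision correlation $(\tau^{\rm AP}+1)/2$. For real sequences write $a_n\gtrsim b_n$ (or $b_n\lesssim a_n$) if there is a constant $C$ with $|b_n|\le C|a_n|$ for all sufficiently large $n$, and $a_n\gnsim b_n$ if $a_n\gtrsim b_n$ holds but $a_n\lesssim b_n$ does not. Let $\delta_n\in(0,1)$ and $p_n\in(0,1)$, $n\ge 1$, be sequences such that for all sufficiently large $n$ and each $i\in\{1,\dots,n\}$ at least one of the following holds (which one may depend on $n$ and $i$): (i) $P\{P(X_j>X_i\mid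 X_i)-P(X_j>X_i)\in[\delta_n,1]\ \text{for all } j\in\{1,\dots,n\}\setminus\{i\}\}\ge p_n$; (ii) $P\{P(X_j>X_i\mid X_i)-P(X_j>X_i)\in[-1,-\delta_n]\ \text{for all } j\in\{1,\dots,n\}\setminus\{i\}\}\ge p_n$. Then: (a) if $\delta_n^3p_n\gnsim n^{-1/3}$, then ${\rm Var}(U_n^{\rm Ken})^{-1/2}\{U_n^{\rm Ken}-E(U_n^{\rm Ken})\}$ converges in distribution to $N(0,1)$ as $n\to\infty$; (b) if $\delta_n^3p_n\gnsim n^{-1/3}(\log n)^2$, then ${\rm Var}(U_n^{\rm AP})^{-1/2}\{U_n^{\rm AP}-E(U_n^{\rm AP})\}$ converges in distribution to $N(0,1)$ as $n\to\infty$. -/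

import Mathlib

open MeasureTheory ProbabilityTheory Filter Topology Asymptotics

noncomputable section

/-- The weighted U-statistic of degree two with weight `a` and kernel `h(x, y) = 𝟙(y > x)`:
`1 / (n (n - 1)) * ∑_{i ≠ j} a(i, j) 𝟙(x_j > x_i)`. -/
def weightedRankStat {n : ℕ} (a : Fin n → Fin n → ℝ) (x : Fin n → ℝ) : ℝ :=
  1 / ((n : ℝ) * ((n : ℝ) - 1)) *
    ∑ i : Fin n, ∑ j : Fin n, if j ≠ i then a i j * (if x i < x j then 1 else 0) else 0

/-- The (affinely rescaled) Kendall's tau `(τ^Ken + 1) / 4`: the weight is `𝟙(j < i)`. -/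
def kendallU {n : ℕ} (x : Fin n → ℝ) : ℝ :=
  weightedRankStat (fun i j => if j < i then 1 else 0) x

/-- The (affinely rescaled) average-precision correlation `(τ^AP + 1) / 2`: the weight is
`n 𝟙(j < i) / (i - 1)` for indices counted from `1`. An index `i : Fin n` is counted from `0`, so
`i - 1` becomes `(i : ℕ)`; it is positive whenever some `j < i` exists. -/
def apU {n : ℕ} (x : Fin n → ℝ) : ℝ :=
  weightedRankStat (fun i j => if j < i then (n : ℝ) / ((i : ℕ) : ℝ) else 0) x

/-- `a ⋧ b`: `a ≳ b` holds, that is `|b n| ≤ C |a n|` for some constant `C` and all large `n`, but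
`a ≲ b` does not. -/
def StrictlyGtrsim (a b : ℕ → ℝ) : Prop :=
  b =O[atTop] a ∧ ¬ a =O[atTop] b

/-- `P(X_j > X_i ∣ X_i) - P(X_j > X_i)` as a function on the probability space, where the first
term is the conditional probability given the σ-algebra generated by `X_i`. -/
def centeredCondProb {Ω : Type*} [MeasurableSpace Ω] (μ : Measure Ω) {n : ℕ}
    (X : Fin n → Ω → ℝ) (i j : Fin n) (ω : Ω) : ℝ :=
  (μ⟦{ω' | X i ω' < X j ω'} | MeasurableSpace.comap (X i) inferInstance⟧) ω
    - μ.real {ω' | X i ω' < X j ω'}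

/-- `Var(U_n)^{-1/2} (U_n - E U_n)` converges in distribution to `N(0, 1)`; the probability space
may change with `n`. -/
def AsymptoticallyNormal {Ω : ℕ → Type*} [∀ n, MeasurableSpace (Ω n)]
    (μ : ∀ n, Measure (Ω n)) [∀ n, IsProbabilityMeasure (μ n)] (U : ∀ n, Ω n → ℝ) : Prop :=
  TendstoInDistribution
    (fun n ω => (Var[U n; μ n]) ^ (-(1 / 2) : ℝ) * (U n ω - ∫ ω', U n ω' ∂(μ n)))
    atTop (id : ℝ → ℝ) μ (gaussianReal 0 1)

end

/-! Both statistics are sums of `b i j * 𝟙(X i < X j)` with strictly lower triangular weights `b i j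
= c * u i`. By Hoeffding, such a sum is a constant, plus independent centred terms, one for each
coordinate (the Hájek projection), plus a degenerate remainder orthogonal to them
(`hoeffding_decomposition`). Normality follows once the variance `v` guaranteed by the Hájek part
dominates both the squared sup bound of a single term and the second moment of the remainder
(`asymptoticallyNormal_of_sum_add_remainder`, by characteristic functions).

Let `L` bound the mean of the `u i`: it is `1` for Kendall and `1 + log n` for average precision. A
Hájek term is at most `c n (1 + L)`, and the remainder has second moment at most `4 c² n² L`, since
degenerate kernels of distinct pairs are orthogonal. For the variance, take `k` among the last `δ n
/ 8` or so indices. There row `k` contributes at least `c δ n / 2` in modulus with probability at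
least `p`, because all its conditional deviations share a sign; column `k` is too short to cancel
more than half of that. Summing over these `k` gives `v` of order `δ³ p c² n³`
(`le_sum_integral_hajekTerm_sq`). Both ratios are then `O(L² / (δ³ p n))`, and the assumed rate
makes this `O(n^(-2/3))`. -/

/-! ### Characteristic function estimates for bounded independent sums -/

theorem norm_prod_sub_prod_le_sum {ι : Type*} (s : Finset ι) (a b : ι → ℂ)
    (ha : ∀ i ∈ s, ‖a i‖ ≤ 1) (hb : ∀ i ∈ s, ‖b i‖ ≤ 1) :
    ‖∏ i ∈ s, a i - ∏ i ∈ s, b i‖ ≤ ∑ i ∈ s, ‖a i - b i‖ := by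
  classical
  induction s using Finset.induction_on with
  | empty => simp
  | insert i s hi ih =>
    rw [Finset.prod_insert hi, Finset.prod_insert hi, Finset.sum_insert hi]
    have h1 : ‖∏ j ∈ s, a j‖ ≤ 1 := by
      rw [norm_prod]
      exact Finset.prod_le_one (fun _ _ => norm_nonneg _)
        fun j hj => ha j (Finset.mem_insert_of_mem hj)
    have h2 := ih (fun j hj => ha j (Finset.mem_insert_of_mem hj))
      (fun j hj => hb j (Finset.mem_insert_of_mem hj))
    have h3 := hb i (Finset.mem_insert_self _ _)
    calc ‖a i * ∏ j ∈ s, a j - b i * ∏ j ∈ s, b j‖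
        = ‖(a i - b i) * ∏ j ∈ s, a j + b i * (∏ j ∈ s, a j - ∏ j ∈ s, b j)‖ := by ring_nf
      _ ≤ ‖a i - b i‖ * ‖∏ j ∈ s, a j‖ + ‖b i‖ * ‖∏ j ∈ s, a j - ∏ j ∈ s, b j‖ := by
        simpa only [norm_mul] using norm_add_le ((a i - b i) * ∏ j ∈ s, a j)
          (b i * (∏ j ∈ s, a j - ∏ j ∈ s, b j))
      _ ≤ ‖a i - b i‖ * 1 + 1 * ‖∏ j ∈ s, a j - ∏ j ∈ s, b j‖ := by gcongr
      _ ≤ _ := by linarith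

theorem norm_exp_mul_I_sub_taylor_le {x : ℝ} (hx : |x| ≤ 1) :
    ‖Complex.exp (x * Complex.I) - 1 - x * Complex.I + (x ^ 2 / 2 : ℝ)‖ ≤ |x| ^ 3 := by
  have hn : ‖(x * Complex.I : ℂ)‖ = |x| := by simp
  have h := Complex.exp_bound (x := x * Complex.I) (by rw [hn]; exact hx) (n := 3) (by norm_num)
  rw [hn] at h
  simp only [Finset.sum_range_succ, Finset.sum_range_zero] at h
  have e : Complex.exp (x * Complex.I) - 1 - x * Complex.I + (x ^ 2 / 2 : ℝ)
      = Complex.exp (x * Complex.I) - (0 + (x * Complex.I) ^ 0 / (Nat.factorial 0 : ℂ)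
        + (x * Complex.I) ^ 1 / (Nat.factorial 1 : ℂ)
        + (x * Complex.I) ^ 2 / (Nat.factorial 2 : ℂ)) := by
    simp [mul_pow]; ring
  rw [e]
  refine h.trans ?_
  have : 0 ≤ |x| ^ 3 := by positivity
  norm_num [Nat.factorial]
  linarith

section
variable {Ω : Type*} [MeasurableSpace Ω] {μ : Measure Ω}

theorem charFun_map_eq_integral {Y : Ω → ℝ} (hY : Measurable Y) (t : ℝ) :
    charFun (μ.map Y) t = ∫ ω, Complex.exp ((t * Y ω : ℝ) * Complex.I) ∂μ := by
  rw [charFun_apply_real, integral_map hY.aemeasurable (by fun_prop)]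
  simp

variable [IsProbabilityMeasure μ]

theorem integrable_exp_mul_I {Y : Ω → ℝ} (hY : Measurable Y) :
    Integrable (fun ω => Complex.exp ((Y ω : ℝ) * Complex.I)) μ := by
  refine Integrable.of_bound (by fun_prop) 1 (ae_of_all _ fun ω => ?_)
  rw [Complex.norm_exp_ofReal_mul_I]

/-- The characteristic function of a bounded centered variable is close to a Gaussian one. -/
theorem norm_charFun_sub_exp_le {Y : Ω → ℝ} (hY : Measurable Y) {ε t : ℝ}
    (hb : ∀ ω, |Y ω| ≤ ε) (h0 : ∫ ω, Y ω ∂μ = 0) (ht : |t| * ε ≤ 1) :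
    ‖charFun (μ.map Y) t - Complex.exp ((-(t ^ 2 / 2 * ∫ ω, Y ω ^ 2 ∂μ) : ℝ))‖
      ≤ 2 * |t| ^ 3 * ε * ∫ ω, Y ω ^ 2 ∂μ := by
  have hε : 0 ≤ ε := by
    obtain ⟨ω⟩ : Nonempty Ω := μ.nonempty_of_neZero
    exact (abs_nonneg _).trans (hb ω)
  have hsq : ∀ ω, Y ω ^ 2 ≤ ε ^ 2 := fun ω => by
    rw [← sq_abs]; exact pow_le_pow_left₀ (abs_nonneg _) (hb ω) 2
  have hi1 : Integrable Y μ := Integrable.of_bound (by fun_prop) ε (ae_of_all _ hb)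
  have hi2 : Integrable (fun ω => Y ω ^ 2) μ :=
    Integrable.of_bound (by fun_prop) (ε ^ 2) (ae_of_all _ fun ω => by
      rw [Real.norm_eq_abs, abs_of_nonneg (sq_nonneg _)]; exact hsq ω)
  set s := ∫ ω, Y ω ^ 2 ∂μ with hs
  have hs0 : 0 ≤ s := integral_nonneg fun ω => sq_nonneg _
  have hsε : s ≤ ε ^ 2 := by
    calc s ≤ ∫ _, ε ^ 2 ∂μ := integral_mono hi2 (integrable_const _) hsq
      _ = ε ^ 2 := by simp
  have hx : ∀ ω, |t * Y ω| ≤ |t| * ε := fun ω => by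
    rw [abs_mul]; exact mul_le_mul_of_nonneg_left (hb ω) (abs_nonneg _)
  -- Centering kills the linear Taylor term, so only the cubic remainder is left under the integral.
  have key : charFun (μ.map Y) t - 1 + (t ^ 2 / 2 * s : ℝ)
      = ∫ ω, (Complex.exp ((t * Y ω : ℝ) * Complex.I) - 1 - ((t * Y ω : ℝ) : ℂ) * Complex.I
        + (((t * Y ω) ^ 2 / 2 : ℝ) : ℂ)) ∂μ := by
    have i1 : Integrable (fun ω => Complex.exp ((t * Y ω : ℝ) * Complex.I)) μ :=
      integrable_exp_mul_I (hY.const_mul t)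
    have i2 : Integrable (fun ω => ((t * Y ω : ℝ) : ℂ) * Complex.I) μ :=
      ((hi1.const_mul t).ofReal).mul_const _
    have i3 : Integrable (fun ω => (((t * Y ω) ^ 2 / 2 : ℝ) : ℂ)) μ := by
      have e : (fun ω => (t * Y ω) ^ 2 / 2) = fun ω => t ^ 2 / 2 * Y ω ^ 2 := by ext ω; ring
      have i : Integrable (fun ω => (t * Y ω) ^ 2 / 2) μ := by rw [e]; exact hi2.const_mul _
      exact i.ofReal
    have e2 : ∫ ω, ((t * Y ω : ℝ) : ℂ) * Complex.I ∂μ = 0 := by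
      rw [integral_mul_const, integral_complex_ofReal, integral_const_mul, h0]; simp
    have e3 : ∫ ω, (((t * Y ω) ^ 2 / 2 : ℝ) : ℂ) ∂μ = (t ^ 2 / 2 * s : ℝ) := by
      rw [integral_complex_ofReal, hs, ← integral_const_mul]
      congr 2; ext ω; ring
    have i4 : Integrable (fun ω => Complex.exp ((t * Y ω : ℝ) * Complex.I) - 1) μ :=
      i1.sub (integrable_const _)
    have i5 : Integrable (fun ω => Complex.exp ((t * Y ω : ℝ) * Complex.I) - 1
        - ((t * Y ω : ℝ) : ℂ) * Complex.I) μ := i4.sub i2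
    rw [integral_add i5 i3, integral_sub i4 i2, integral_sub i1 (integrable_const _),
      e2, e3, charFun_map_eq_integral hY]
    simp
  have b1 : ‖charFun (μ.map Y) t - 1 + (t ^ 2 / 2 * s : ℝ)‖ ≤ |t| ^ 3 * ε * s := by
    rw [key]
    calc _ ≤ ∫ ω, |t| ^ 3 * ε * Y ω ^ 2 ∂μ := by
          refine norm_integral_le_of_norm_le (hi2.const_mul _) (ae_of_all _ fun ω => ?_)
          refine (norm_exp_mul_I_sub_taylor_le ((hx ω).trans ht)).trans ?_
          rw [abs_mul, mul_pow]
          have : |Y ω| ^ 3 ≤ ε * Y ω ^ 2 := by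
            rw [pow_succ, sq_abs, mul_comm]
            exact mul_le_mul_of_nonneg_right (hb ω) (sq_nonneg _)
          calc |t| ^ 3 * |Y ω| ^ 3 ≤ |t| ^ 3 * (ε * Y ω ^ 2) := by gcongr
            _ = _ := by ring
      _ = _ := by rw [integral_const_mul]
  -- As `s ≤ ε²`, the Gaussian exponent is at most `|t| ε`, so its square, the error in linearising
  -- the exponential, has the same order `|t|³ ε s` as the Taylor error.
  have hz : t ^ 2 / 2 * s ≤ 1 / 2 * (|t| * ε) ^ 2 := by
    have : t ^ 2 / 2 * s ≤ t ^ 2 / 2 * ε ^ 2 := by gcongr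
    rw [mul_pow, sq_abs]; linarith
  have hte : 0 ≤ |t| * ε := by positivity
  have b2 : |Real.exp (-(t ^ 2 / 2 * s)) - 1 - (-(t ^ 2 / 2 * s))| ≤ |t| ^ 3 * ε * s := by
    have hz0 : 0 ≤ t ^ 2 / 2 * s := by positivity
    refine (Real.abs_exp_sub_one_sub_id_le (x := -(t ^ 2 / 2 * s)) ?_).trans ?_
    · rw [abs_neg, abs_of_nonneg hz0]; nlinarith
    · have : t ^ 2 / 2 * s ≤ |t| * ε := by nlinarith
      calc (-(t ^ 2 / 2 * s)) ^ 2 = (t ^ 2 / 2 * s) * (t ^ 2 / 2 * s) := by ring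
        _ ≤ (t ^ 2 / 2 * s) * (|t| * ε) := by gcongr
        _ = 1 / 2 * (|t| ^ 3 * ε * s) := by rw [← sq_abs]; ring
        _ ≤ _ := by
          have : 0 ≤ |t| ^ 3 * ε * s := by positivity
          linarith
  have b2' : ‖Complex.exp ((-(t ^ 2 / 2 * s) : ℝ)) - 1 + (t ^ 2 / 2 * s : ℝ)‖
      ≤ |t| ^ 3 * ε * s := by
    rw [← Real.norm_eq_abs, ← Complex.norm_real] at b2
    convert b2 using 2
    push_cast; ring
  calc _ = ‖(charFun (μ.map Y) t - 1 + (t ^ 2 / 2 * s : ℝ))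
        - (Complex.exp ((-(t ^ 2 / 2 * s) : ℝ)) - 1 + (t ^ 2 / 2 * s : ℝ))‖ := by
        congr 1; ring
    _ ≤ |t| ^ 3 * ε * s + |t| ^ 3 * ε * s := (norm_sub_le _ _).trans (add_le_add b1 b2')
    _ = _ := by ring

/-- This is nonnegativity of the variance of `|R|`. -/
theorem integral_abs_le_sqrt_integral_sq {R : Ω → ℝ} (hR : MemLp R 2 μ) :
    ∫ ω, |R ω| ∂μ ≤ √(∫ ω, R ω ^ 2 ∂μ) := by
  refine Real.le_sqrt_of_sq_le ?_
  have h := variance_nonneg (fun ω => |R ω|) μ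
  have hR' : MemLp (fun ω => |R ω|) 2 μ := hR.abs
  rw [variance_eq_sub hR'] at h
  simpa using h

/-- Gaussian comparison for a sum of bounded independent variables plus a small remainder. -/
theorem norm_charFun_sum_add_sub_exp_le {ι : Type*} [Fintype ι] {Y : ι → Ω → ℝ} {R : Ω → ℝ}
    (hY : ∀ i, Measurable (Y i)) (hind : iIndepFun Y μ) {ε t : ℝ}
    (hb : ∀ i ω, |Y i ω| ≤ ε) (h0 : ∀ i, ∫ ω, Y i ω ∂μ = 0) (ht : |t| * ε ≤ 1)
    (hRm : Measurable R) (hR : MemLp R 2 μ) :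
    ‖charFun (μ.map fun ω => ∑ i, Y i ω + R ω) t
        - Complex.exp ((-(t ^ 2 / 2 * ∑ i, ∫ ω, Y i ω ^ 2 ∂μ) : ℝ))‖
      ≤ 2 * |t| ^ 3 * ε * ∑ i, ∫ ω, Y i ω ^ 2 ∂μ + |t| * √(∫ ω, R ω ^ 2 ∂μ) := by
  have hSm : Measurable fun ω => ∑ i, Y i ω := by fun_prop
  have b1 : ‖charFun (μ.map fun ω => ∑ i, Y i ω + R ω) t - charFun (μ.map fun ω => ∑ i, Y i ω) t‖
      ≤ |t| * √(∫ ω, R ω ^ 2 ∂μ) := by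
    have hSR : Measurable fun ω => ∑ i, Y i ω + R ω := hSm.add hRm
    rw [charFun_map_eq_integral hSR, charFun_map_eq_integral hSm,
      ← integral_sub (integrable_exp_mul_I (hSR.const_mul t))
        (integrable_exp_mul_I (hSm.const_mul t))]
    calc _ ≤ ∫ ω, |t| * |R ω| ∂μ := by
          refine norm_integral_le_of_norm_le
            (((hR.integrable (by norm_num)).abs).const_mul _) (ae_of_all _ fun ω => ?_)
          -- Factoring out a unimodular number leaves `|exp(i t R) - 1| ≤ |t R|`; no independence of
          -- `R` from the sum is needed.
          have e : Complex.exp ((t * (∑ i, Y i ω + R ω) : ℝ) * Complex.I)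
              - Complex.exp ((t * ∑ i, Y i ω : ℝ) * Complex.I)
              = Complex.exp ((t * ∑ i, Y i ω : ℝ) * Complex.I)
                * (Complex.exp (Complex.I * (t * R ω : ℝ)) - 1) := by
            rw [mul_sub, ← Complex.exp_add, mul_one]
            congr 2; push_cast; ring
          rw [e, norm_mul, Complex.norm_exp_ofReal_mul_I, one_mul, ← abs_mul]
          exact Real.norm_exp_I_mul_ofReal_sub_one_le
      _ ≤ _ := by
          rw [integral_const_mul]
          exact mul_le_mul_of_nonneg_left (integral_abs_le_sqrt_integral_sq hR) (abs_nonneg _)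
  have b2 : ‖charFun (μ.map fun ω => ∑ i, Y i ω) t
        - Complex.exp ((-(t ^ 2 / 2 * ∑ i, ∫ ω, Y i ω ^ 2 ∂μ) : ℝ))‖
      ≤ 2 * |t| ^ 3 * ε * ∑ i, ∫ ω, Y i ω ^ 2 ∂μ := by
    have e1 := congrFun (hind.charFun_map_fun_sum_eq_prod fun i => (hY i).aemeasurable) t
    rw [e1, Finset.mul_sum, ← Finset.sum_neg_distrib, Complex.ofReal_sum, Complex.exp_sum,
      Finset.mul_sum, Finset.prod_apply]
    refine (norm_prod_sub_prod_le_sum _ _ _ (fun i _ => ?_) (fun i _ => ?_)).trans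
      (Finset.sum_le_sum fun i _ => norm_charFun_sub_exp_le (hY i) (hb i) (h0 i) ht)
    · have := Measure.isProbabilityMeasure_map (μ := μ) (hY i).aemeasurable
      exact norm_charFun_le_one t
    · rw [← Complex.ofReal_exp, Complex.norm_real, Real.norm_eq_abs, Real.abs_exp,
        Real.exp_le_one_iff, neg_nonpos]
      have : 0 ≤ ∫ ω, Y i ω ^ 2 ∂μ := integral_nonneg fun ω => sq_nonneg _
      positivity
  calc _ = ‖(charFun (μ.map fun ω => ∑ i, Y i ω) t
        - Complex.exp ((-(t ^ 2 / 2 * ∑ i, ∫ ω, Y i ω ^ 2 ∂μ) : ℝ)))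
        + (charFun (μ.map fun ω => ∑ i, Y i ω + R ω) t
          - charFun (μ.map fun ω => ∑ i, Y i ω) t)‖ := by congr 1; ring
    _ ≤ _ := (norm_add_le _ _).trans (add_le_add b2 b1)

end

/-! ### A central limit theorem for independent sums with an orthogonal remainder -/

section
variable {Ω : Type*} [MeasurableSpace Ω] {μ : Measure Ω} [IsProbabilityMeasure μ]

theorem variance_const_add_sum_add {ι : Type*} [Fintype ι] {Y : ι → Ω → ℝ} {R : Ω → ℝ} (m : ℝ)
    (hY : ∀ i, MemLp (Y i) 2 μ) (hind : iIndepFun Y μ) (h0 : ∀ i, ∫ ω, Y i ω ∂μ = 0)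
    (hR : MemLp R 2 μ) (hR0 : ∫ ω, R ω ∂μ = 0) (hYR : ∀ i, ∫ ω, Y i ω * R ω ∂μ = 0) :
    Var[fun ω => m + (∑ i, Y i ω + R ω); μ]
      = ∑ i, ∫ ω, Y i ω ^ 2 ∂μ + ∫ ω, R ω ^ 2 ∂μ := by
  have hS : MemLp (∑ i, Y i) 2 μ := memLp_finsetSum' _ fun i _ => hY i
  have e1 : Var[fun ω => m + (∑ i, Y i ω + R ω); μ] = Var[(∑ i, Y i) + R; μ] := by
    rw [← variance_const_add (hS.add hR).aestronglyMeasurable m]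
    congr 1; ext ω; simp
  have e2 : cov[∑ i, Y i, R; μ] = 0 := by
    rw [covariance_sum_left hY hR]
    refine Finset.sum_eq_zero fun i _ => ?_
    rw [covariance_eq_sub (hY i) hR, hR0, mul_zero, sub_zero]
    exact hYR i
  rw [e1, variance_add hS hR, e2, IndepFun.variance_sum (fun i _ => hY i)
    (fun i _ j _ hij => hind.indepFun hij),
    variance_of_integral_eq_zero hR.aemeasurable hR0]
  simp only [mul_zero, add_zero]
  congr 1
  exact Finset.sum_congr rfl fun i _ =>
    variance_of_integral_eq_zero (hY i).aemeasurable (h0 i)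

end

/-- After standardisation the summands are at most `√(M² / v)` and the remainder has second moment
at most its share over `v`, so a lower bound `v` on the variance suffices; its exact order is not
needed. -/
theorem asymptoticallyNormal_of_sum_add_remainder {Ω : ℕ → Type*} [∀ n, MeasurableSpace (Ω n)]
    {μ : ∀ n, Measure (Ω n)} [∀ n, IsProbabilityMeasure (μ n)]
    {W : ∀ n, Ω n → ℝ} {Y : ∀ n, Fin n → Ω n → ℝ} {R : ∀ n, Ω n → ℝ} {m M v : ℕ → ℝ}
    (hYm : ∀ n i, Measurable (Y n i)) (hRm : ∀ n, Measurable (R n))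
    (hind : ∀ n, iIndepFun (Y n) (μ n)) (hY0 : ∀ n i, ∫ ω, Y n i ω ∂(μ n) = 0)
    (hR : ∀ n, MemLp (R n) 2 (μ n)) (hR0 : ∀ n, ∫ ω, R n ω ∂(μ n) = 0)
    (hYR : ∀ n i, ∫ ω, Y n i ω * R n ω ∂(μ n) = 0)
    (hW : ∀ n ω, W n ω = m n + (∑ i, Y n i ω + R n ω))
    (hM : ∀ᶠ n in atTop, ∀ i ω, |Y n i ω| ≤ M n) (hv : ∀ᶠ n in atTop, 0 < v n)
    (hvY : ∀ᶠ n in atTop, v n ≤ ∑ i, ∫ ω, Y n i ω ^ 2 ∂(μ n))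
    (hMv : Tendsto (fun n => M n ^ 2 / v n) atTop (𝓝 0))
    (hRv : Tendsto (fun n => (∫ ω, R n ω ^ 2 ∂(μ n)) / v n) atTop (𝓝 0)) :
    AsymptoticallyNormal μ W := by
  have hWm : ∀ n, Measurable (W n) := fun n => by
    rw [funext (hW n)]
    have h1 := hYm n
    have h2 := hRm n
    fun_prop
  refine ⟨fun n => by have := hWm n; fun_prop, by fun_prop, ?_⟩
  refine ProbabilityMeasure.tendsto_iff_tendsto_charFun.2 fun t => ?_
  simp only [ProbabilityMeasure.coe_mk, Measure.map_id]
  have hMtend : Tendsto (fun n => √(M n ^ 2 / v n)) atTop (𝓝 0) := by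
    simpa [Function.comp_def] using (Real.continuous_sqrt.tendsto 0).comp hMv
  have hRtend : Tendsto (fun n => √((∫ ω, R n ω ^ 2 ∂(μ n)) / v n)) atTop (𝓝 0) := by
    simpa [Function.comp_def] using (Real.continuous_sqrt.tendsto 0).comp hRv
  -- The fraction of variance carried by the remainder. The standardised sum has variance `1 - ρ n`,
  -- so the comparison is first with that Gaussian, and then `ρ` tends to zero.
  set ρ : ℕ → ℝ := fun n => (∫ ω, R n ω ^ 2 ∂(μ n)) / Var[W n; μ n] with hρ
  have hR2 : ∀ n, 0 ≤ ∫ ω, R n ω ^ 2 ∂(μ n) := fun n => integral_nonneg fun ω => sq_nonneg _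
  have hbd : ∀ᶠ n in atTop, ρ n ≤ (∫ ω, R n ω ^ 2 ∂(μ n)) / v n ∧ 0 ≤ ρ n ∧
      (|t| * √(M n ^ 2 / v n) ≤ 1 →
      ‖charFun ((μ n).map fun ω =>
          (Var[W n; μ n]) ^ (-(1 / 2) : ℝ) * (W n ω - ∫ ω', W n ω' ∂(μ n))) t
        - Complex.exp ((-(t ^ 2 / 2 * (1 - ρ n)) : ℝ))‖
      ≤ 2 * |t| ^ 3 * √(M n ^ 2 / v n) + |t| * √((∫ ω, R n ω ^ 2 ∂(μ n)) / v n)) := by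
    filter_upwards [hM, hv, hvY] with n hMn hvn hvYn
    have hYL : ∀ i, MemLp (Y n i) 2 (μ n) := fun i =>
      MemLp.of_bound (hYm n i).aestronglyMeasurable (M n) (ae_of_all _ (hMn i))
    have hVar : Var[W n; μ n] = ∑ i, ∫ ω, Y n i ω ^ 2 ∂(μ n) + ∫ ω, R n ω ^ 2 ∂(μ n) := by
      rw [funext (hW n)]
      exact variance_const_add_sum_add (m n) hYL (hind n) (hY0 n) (hR n) (hR0 n) (hYR n)
    have hvV : v n ≤ Var[W n; μ n] := by rw [hVar]; linarith [hR2 n]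
    have hEW : ∫ ω', W n ω' ∂(μ n) = m n := by
      have i1 : ∀ i, Integrable (Y n i) (μ n) := fun i => (hYL i).integrable (by norm_num)
      have i2 : Integrable (fun ω => ∑ i, Y n i ω) (μ n) := integrable_finsetSum _ fun i _ => i1 i
      have i3 : Integrable (R n) (μ n) := (hR n).integrable (by norm_num)
      have i4 : Integrable (fun ω => ∑ i, Y n i ω + R n ω) (μ n) := i2.add i3
      rw [funext (hW n), integral_add (integrable_const _) i4, integral_add i2 i3,
        integral_finsetSum _ fun i _ => i1 i, hR0 n]
      simp [hY0 n]
    set V := Var[W n; μ n] with hV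
    have hVpos : 0 < V := hvn.trans_le hvV
    have hρle : ρ n ≤ (∫ ω, R n ω ^ 2 ∂(μ n)) / v n :=
      div_le_div_of_nonneg_left (hR2 n) hvn hvV
    have hρ0 : 0 ≤ ρ n := div_nonneg (hR2 n) hVpos.le
    refine ⟨hρle, hρ0, fun ht => ?_⟩
    set c : ℝ := V ^ (-(1 / 2) : ℝ) with hc
    have hcpos : 0 < c := Real.rpow_pos_of_pos hVpos _
    have hc2 : c ^ 2 = 1 / V := by
      rw [hc, ← Real.rpow_natCast, ← Real.rpow_mul hVpos.le]
      norm_num [Real.rpow_neg_one]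
    have hfun : (fun ω => c * (W n ω - ∫ ω', W n ω' ∂(μ n)))
        = fun ω => ∑ i, c * Y n i ω + c * R n ω := by
      ext ω
      rw [hEW, hW, ← Finset.mul_sum]; ring
    have hbound : ∀ i ω, |c * Y n i ω| ≤ √(M n ^ 2 / v n) := fun i ω => by
      refine Real.le_sqrt_of_sq_le ?_
      rw [sq_abs, mul_pow, hc2, one_div, ← sq_abs (Y n i ω), inv_mul_eq_div]
      exact div_le_div₀ (sq_nonneg _) (pow_le_pow_left₀ (abs_nonneg _) (hMn i ω) 2) hvn hvV
    have hsum : ∑ i, ∫ ω, (c * Y n i ω) ^ 2 ∂(μ n) = 1 - ρ n := by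
      simp only [mul_pow, integral_const_mul]
      rw [← Finset.mul_sum, hc2, hρ]
      simp only []
      rw [← hV]
      field_simp
      rw [hVar]; ring
    have hRs : ∫ ω, (c * R n ω) ^ 2 ∂(μ n) = ρ n := by
      simp only [mul_pow, integral_const_mul]
      rw [hc2, hρ]
      simp only []
      rw [← hV]; ring
    have main := norm_charFun_sum_add_sub_exp_le (μ := μ n) (Y := fun i ω => c * Y n i ω)
      (R := fun ω => c * R n ω) (t := t) (fun i => (hYm n i).const_mul c)
      ((hind n).comp (fun _ x => c * x) fun _ => measurable_const_mul c) hbound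
      (fun i => by rw [integral_const_mul, hY0, mul_zero]) ht ((hRm n).const_mul c)
      ((hR n).const_mul c)
    rw [hfun]
    rw [hsum, hRs] at main
    refine main.trans (add_le_add ?_ ?_)
    · have : 0 ≤ 2 * |t| ^ 3 * √(M n ^ 2 / v n) := by positivity
      nlinarith
    · exact mul_le_mul_of_nonneg_left (Real.sqrt_le_sqrt hρle) (abs_nonneg _)
  have hρt : Tendsto ρ atTop (𝓝 0) :=
    tendsto_of_tendsto_of_tendsto_of_le_of_le' tendsto_const_nhds hRv
      (hbd.mono fun n h => h.2.1) (hbd.mono fun n h => h.1)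
  have ht1 : ∀ᶠ n in atTop, |t| * √(M n ^ 2 / v n) ≤ 1 := by
    have := hMtend.const_mul |t|
    rw [mul_zero] at this
    exact this.eventually_le_const one_pos
  have hG : Tendsto (fun n => Complex.exp ((-(t ^ 2 / 2 * (1 - ρ n)) : ℝ))) atTop
      (𝓝 (charFun (gaussianReal 0 1) t)) := by
    have h1 : Tendsto (fun n => -(t ^ 2 / 2 * (1 - ρ n))) atTop (𝓝 (-(t ^ 2 / 2 * (1 - 0)))) :=
      ((tendsto_const_nhds.sub hρt).const_mul _).neg
    have h2 := (Complex.continuous_exp.comp Complex.continuous_ofReal).tendsto _ |>.comp h1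
    have e : charFun (gaussianReal 0 1) t = Complex.exp ((-(t ^ 2 / 2 * (1 - 0)) : ℝ)) := by
      rw [charFun_gaussianReal]
      congr 1; push_cast; ring
    rw [e]
    exact h2
  have hd : Tendsto (fun n => charFun ((μ n).map fun ω =>
          (Var[W n; μ n]) ^ (-(1 / 2) : ℝ) * (W n ω - ∫ ω', W n ω' ∂(μ n))) t
        - Complex.exp ((-(t ^ 2 / 2 * (1 - ρ n)) : ℝ))) atTop (𝓝 0) := by
    refine squeeze_zero_norm' (a := fun n => 2 * |t| ^ 3 * √(M n ^ 2 / v n)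
      + |t| * √((∫ ω, R n ω ^ 2 ∂(μ n)) / v n)) ?_ ?_
    · filter_upwards [hbd, ht1] with n h1 h2 using h1.2.2 h2
    · simpa using (hMtend.const_mul (2 * |t| ^ 3)).add (hRtend.const_mul |t|)
  simpa using hd.add hG

/-! ### Integrating out one independent coordinate -/

section
variable {Ω : Type*} [MeasurableSpace Ω] {μ : Measure Ω} [IsProbabilityMeasure μ]

/-- Conditionally centering in one coordinate gives mean zero under independence. -/
theorem integral_comp_eq_zero_of_integral_update_eq_zero {ι : Type*} [Fintype ι] [DecidableEq ι]
    {X : ι → Ω → ℝ} (hX : ∀ i, Measurable (X i)) (hind : iIndepFun X μ)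
    {F : (ι → ℝ) → ℝ} (hF : Measurable F) {C : ℝ} (hC : ∀ x, |F x| ≤ C) (i : ι)
    (h : ∀ x, ∫ t, F (Function.update x i t) ∂(μ.map (X i)) = 0) :
    ∫ ω, F (fun k => X k ω) ∂μ = 0 := by
  -- Overwriting coordinate `i` by a dummy `0` makes `Z` a function of the other coordinates, hence
  -- independent of `X i`; writing `X i` back recovers the sample, and Fubini applies.
  set Z : Ω → ι → ℝ := fun ω => Function.update (fun k => X k ω) i 0 with hZ
  have hZm : Measurable Z := by
    refine measurable_pi_iff.2 fun k => ?_
    by_cases hk : k = i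
    · subst hk; simp [hZ]
    · simpa [hZ, hk] using hX k
  have hXZ : IndepFun (X i) Z μ := by
    have h1 := hind.indepFun_finset {i} {i}ᶜ disjoint_compl_right hX
    have m1 : Measurable fun x : (({i} : Finset ι) → ℝ) => x ⟨i, by simp⟩ :=
      measurable_pi_apply _
    have m2 : Measurable fun (z : (({i}ᶜ : Finset ι) → ℝ)) (k : ι) =>
        if hk : k ∈ ({i}ᶜ : Finset ι) then z ⟨k, hk⟩ else 0 := by
      refine measurable_pi_iff.2 fun k => ?_
      by_cases hk : k ∈ ({i}ᶜ : Finset ι)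
      · simp only [hk, dite_true]; exact measurable_pi_apply _
      · simp only [hk, dite_false]; exact measurable_const
    have h2 := h1.comp m1 m2
    have eZ : Z = (fun (z : (({i}ᶜ : Finset ι) → ℝ)) (k : ι) =>
        if hk : k ∈ ({i}ᶜ : Finset ι) then z ⟨k, hk⟩ else 0) ∘ fun ω k => X k ω := by
      ext ω k
      by_cases hk : k = i
      · subst hk; simp [hZ]
      · simp [hZ, hk]
    rw [eZ]
    exact h2
  have hu : Measurable fun p : ℝ × (ι → ℝ) => Function.update p.2 i p.1 := by
    refine measurable_pi_iff.2 fun k => ?_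
    by_cases hk : k = i
    · subst hk; simpa using measurable_fst
    · simp only [Function.update_of_ne hk]
      exact (measurable_pi_apply k).comp measurable_snd
  have hFu : Measurable fun p : ℝ × (ι → ℝ) => F (Function.update p.2 i p.1) := hF.comp hu
  have e : (fun ω => F (fun k => X k ω))
      = fun ω => (fun p : ℝ × (ι → ℝ) => F (Function.update p.2 i p.1)) (X i ω, Z ω) := by
    ext ω
    simp only [hZ, Function.update_idem]
    congr 1
    ext k
    by_cases hk : k = i
    · subst hk; simp
    · simp [hk]
  have := Measure.isProbabilityMeasure_map (μ := μ) (hX i).aemeasurable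
  have := Measure.isProbabilityMeasure_map (μ := μ) hZm.aemeasurable
  rw [e, ← integral_map (f := fun p : ℝ × (ι → ℝ) => F (Function.update p.2 i p.1))
      ((hX i).prodMk hZm).aemeasurable hFu.aestronglyMeasurable,
    (indepFun_iff_map_prod_eq_prod_map_map (hX i).aemeasurable hZm.aemeasurable).1 hXZ,
    integral_prod_symm _ (Integrable.of_bound hFu.aestronglyMeasurable C
      (ae_of_all _ fun p => hC _))]
  simp [h]

end

/-! ### Hoeffding decomposition of the kernel -/

noncomputable section

/-- The indicator of `x < y`. -/
def ltInd (x y : ℝ) : ℝ := if x < y then 1 else 0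

/-- `P(X < Y)` for independent `X ∼ α`, `Y ∼ β`. -/
def ltProb (α β : Measure ℝ) : ℝ := ∫ x, β.real (Set.Ioi x) ∂α

/-- The first-coordinate Hájek projection of `𝟙(X < Y)`. -/
def projFst (α β : Measure ℝ) (x : ℝ) : ℝ := β.real (Set.Ioi x) - ltProb α β

/-- The second-coordinate Hájek projection of `𝟙(X < Y)`. -/
def projSnd (α β : Measure ℝ) (y : ℝ) : ℝ := α.real (Set.Iio y) - ltProb α β

/-- The degenerate part of `𝟙(X < Y)`. -/
def degPart (α β : Measure ℝ) (x y : ℝ) : ℝ :=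
  ltInd x y - ltProb α β - projFst α β x - projSnd α β y

section
variable (α β : Measure ℝ)

@[fun_prop]
theorem measurable_ltInd : Measurable fun p : ℝ × ℝ => ltInd p.1 p.2 :=
  Measurable.ite (measurableSet_lt measurable_fst measurable_snd) measurable_const measurable_const

theorem measurable_ltInd_comp {γ : Type*} [MeasurableSpace γ] {f g : γ → ℝ} (hf : Measurable f)
    (hg : Measurable g) : Measurable fun c => ltInd (f c) (g c) :=
  measurable_ltInd.comp (hf.prodMk hg)

@[fun_prop]
theorem measurable_real_Ioi [IsProbabilityMeasure β] : Measurable fun x => β.real (Set.Ioi x) :=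
  Antitone.measurable fun _ _ h => measureReal_mono (Set.Ioi_subset_Ioi h)

@[fun_prop]
theorem measurable_real_Iio [IsProbabilityMeasure α] : Measurable fun x => α.real (Set.Iio x) :=
  Monotone.measurable fun _ _ h => measureReal_mono (Set.Iio_subset_Iio h)

@[fun_prop]
theorem measurable_projFst [IsProbabilityMeasure β] : Measurable (projFst α β) :=
  (measurable_real_Ioi β).sub_const _

@[fun_prop]
theorem measurable_projSnd [IsProbabilityMeasure α] : Measurable (projSnd α β) :=
  (measurable_real_Iio α).sub_const _

theorem integral_ltInd_right (x : ℝ) : ∫ y, ltInd x y ∂β = β.real (Set.Ioi x) := by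
  rw [← integral_indicator_one measurableSet_Ioi]
  rfl

theorem integral_ltInd_left (y : ℝ) : ∫ x, ltInd x y ∂α = α.real (Set.Iio y) := by
  rw [← integral_indicator_one measurableSet_Iio]
  rfl

variable [IsProbabilityMeasure α] [IsProbabilityMeasure β]

theorem integrable_real_Ioi : Integrable (fun x => β.real (Set.Ioi x)) α :=
  Integrable.of_bound (measurable_real_Ioi β).aestronglyMeasurable 1 (ae_of_all _ fun x => by
    rw [Real.norm_eq_abs, abs_of_nonneg measureReal_nonneg]; exact measureReal_le_one)

theorem integrable_real_Iio : Integrable (fun x => β.real (Set.Iio x)) α :=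
  Integrable.of_bound (measurable_real_Iio β).aestronglyMeasurable 1 (ae_of_all _ fun x => by
    rw [Real.norm_eq_abs, abs_of_nonneg measureReal_nonneg]; exact measureReal_le_one)

theorem measurable_degPart : Measurable fun p : ℝ × ℝ => degPart α β p.1 p.2 := by
  unfold degPart
  exact ((measurable_ltInd.sub_const _).sub ((measurable_projFst α β).comp measurable_fst)).sub
    ((measurable_projSnd α β).comp measurable_snd)

theorem measurable_degPart_comp {γ : Type*} [MeasurableSpace γ] {f g : γ → ℝ} (hf : Measurable f)
    (hg : Measurable g) : Measurable fun c => degPart α β (f c) (g c) :=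
  (measurable_degPart α β).comp (hf.prodMk hg)

theorem ltInd_mem (x y : ℝ) : 0 ≤ ltInd x y ∧ ltInd x y ≤ 1 := by
  unfold ltInd; split_ifs <;> simp

theorem integrable_ltInd_right (x : ℝ) : Integrable (fun y => ltInd x y) β := by
  refine Integrable.of_bound (C := 1)
    (measurable_ltInd.comp measurable_prodMk_left).aestronglyMeasurable (ae_of_all _ fun y => ?_)
  rw [Real.norm_eq_abs, abs_of_nonneg (ltInd_mem x y).1]; exact (ltInd_mem x y).2

theorem integrable_ltInd_left (y : ℝ) : Integrable (fun x => ltInd x y) α := by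
  refine Integrable.of_bound (C := 1)
    (measurable_ltInd.comp measurable_prodMk_right).aestronglyMeasurable (ae_of_all _ fun x => ?_)
  rw [Real.norm_eq_abs, abs_of_nonneg (ltInd_mem x y).1]; exact (ltInd_mem x y).2

theorem ltProb_eq_integral_Iio : ltProb α β = ∫ y, α.real (Set.Iio y) ∂β := by
  simp only [ltProb, ← integral_ltInd_right, ← integral_ltInd_left]
  refine integral_integral_swap (f := ltInd) (Integrable.of_bound (C := 1)
    measurable_ltInd.aestronglyMeasurable (ae_of_all _ fun p => ?_))
  change |ltInd p.1 p.2| ≤ 1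
  rw [abs_of_nonneg (ltInd_mem _ _).1]; exact (ltInd_mem _ _).2

theorem ltProb_mem : 0 ≤ ltProb α β ∧ ltProb α β ≤ 1 := by
  refine ⟨integral_nonneg fun _ => measureReal_nonneg, ?_⟩
  calc ltProb α β ≤ ∫ _, (1 : ℝ) ∂α :=
        integral_mono (integrable_real_Ioi α β) (integrable_const _) fun _ => measureReal_le_one
    _ = 1 := by simp

theorem integral_projFst : ∫ x, projFst α β x ∂α = 0 := by
  unfold projFst
  rw [integral_sub (integrable_real_Ioi α β) (integrable_const _)]
  simp [ltProb]

theorem integral_projSnd : ∫ y, projSnd α β y ∂β = 0 := by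
  unfold projSnd
  rw [integral_sub (integrable_real_Iio β α) (integrable_const _), ← ltProb_eq_integral_Iio]
  simp

theorem abs_projFst_le (x : ℝ) : |projFst α β x| ≤ 1 := by
  have h1 := ltProb_mem α β
  have h2 : 0 ≤ β.real (Set.Ioi x) := measureReal_nonneg
  have h3 : β.real (Set.Ioi x) ≤ 1 := measureReal_le_one
  unfold projFst
  rw [abs_le]; constructor <;> linarith

theorem abs_projSnd_le (y : ℝ) : |projSnd α β y| ≤ 1 := by
  have h1 := ltProb_mem α β
  have h2 : 0 ≤ α.real (Set.Iio y) := measureReal_nonneg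
  have h3 : α.real (Set.Iio y) ≤ 1 := measureReal_le_one
  unfold projSnd
  rw [abs_le]; constructor <;> linarith

theorem abs_degPart_le (x y : ℝ) : |degPart α β x y| ≤ 2 := by
  have h1 := ltProb_mem α β
  have h2 : 0 ≤ α.real (Set.Iio y) := measureReal_nonneg
  have h3 : α.real (Set.Iio y) ≤ 1 := measureReal_le_one
  have h4 : 0 ≤ β.real (Set.Ioi x) := measureReal_nonneg
  have h5 : β.real (Set.Ioi x) ≤ 1 := measureReal_le_one
  have h6 := ltInd_mem x y
  -- Once the centering constants combine, the value is an indicator plus a probability minus two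
  -- probabilities.
  unfold degPart projSnd projFst
  rw [abs_le]; constructor <;> linarith

theorem integrable_projFst : Integrable (projFst α β) α :=
  Integrable.of_bound (measurable_projFst α β).aestronglyMeasurable 1
    (ae_of_all _ (abs_projFst_le α β))

theorem integrable_projSnd : Integrable (projSnd α β) β :=
  Integrable.of_bound (measurable_projSnd α β).aestronglyMeasurable 1
    (ae_of_all _ (abs_projSnd_le α β))

theorem integral_degPart_left (y : ℝ) : ∫ x, degPart α β x y ∂α = 0 := by
  unfold degPart
  have i1 : Integrable (fun x => ltInd x y - ltProb α β) α :=
    (integrable_ltInd_left α y).sub (integrable_const _)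
  have i2 : Integrable (fun x => ltInd x y - ltProb α β - projFst α β x) α :=
    i1.sub (integrable_projFst α β)
  rw [integral_sub i2 (integrable_const _), integral_sub i1 (integrable_projFst α β),
    integral_sub (integrable_ltInd_left α y) (integrable_const _), integral_ltInd_left,
    integral_projFst]
  simp [projSnd]

theorem integral_degPart_right (x : ℝ) : ∫ y, degPart α β x y ∂β = 0 := by
  unfold degPart
  have i1 : Integrable (fun y => ltInd x y - ltProb α β) β :=
    (integrable_ltInd_right β x).sub (integrable_const _)
  have i2 : Integrable (fun y => ltInd x y - ltProb α β - projFst α β x) β :=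
    i1.sub (integrable_const _)
  rw [integral_sub i2 (integrable_projSnd α β), integral_sub i1 (integrable_const _),
    integral_sub (integrable_ltInd_right β x) (integrable_const _), integral_ltInd_right,
    integral_projSnd]
  simp [projFst]

end

/-! ### Hoeffding decomposition of the weighted sum and its orthogonality -/

section
variable {Ω : Type*} [MeasurableSpace Ω] {μ : Measure Ω} [IsProbabilityMeasure μ]
  {n : ℕ} {X : Fin n → Ω → ℝ}

/-- Integrate over coordinate `l` first: `G` is constant in it, and `degPart` has mean zero in each
argument separately. -/
theorem integral_mul_degPart_eq_zero (hX : ∀ i, Measurable (X i)) (hind : iIndepFun X μ)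
    {G : (Fin n → ℝ) → ℝ} (hG : Measurable G) {C : ℝ} (hC : ∀ x, |G x| ≤ C) {i j l : Fin n}
    (hij : i ≠ j) (hl : l = i ∨ l = j) (hGl : ∀ x t, G (Function.update x l t) = G x) :
    ∫ ω, G (fun k => X k ω) * degPart (μ.map (X i)) (μ.map (X j)) (X i ω) (X j ω) ∂μ = 0 := by
  have hp : ∀ k, IsProbabilityMeasure (μ.map (X k)) := fun k =>
    Measure.isProbabilityMeasure_map (hX k).aemeasurable
  refine integral_comp_eq_zero_of_integral_update_eq_zero hX hind
    (F := fun x => G x * degPart (μ.map (X i)) (μ.map (X j)) (x i) (x j)) (C := C * 2)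
    (hG.mul (measurable_degPart_comp _ _ (measurable_pi_apply i) (measurable_pi_apply j))) (fun x => ?_) l fun x => ?_
  · rw [abs_mul]
    exact mul_le_mul (hC x) (abs_degPart_le _ _ _ _) (abs_nonneg _) ((abs_nonneg _).trans (hC x))
  · simp only [hGl]
    rw [integral_const_mul]
    rcases hl with rfl | rfl
    · simp [Function.update_of_ne hij.symm, integral_degPart_left]
    · simp [Function.update_of_ne hij, integral_degPart_right]

/-- The `k`-th term of the Hájek projection of `∑ b i j 𝟙(X i < X j)`. -/
def hajekTerm (b : Fin n → Fin n → ℝ) (ν : Fin n → Measure ℝ) (k : Fin n) (x : ℝ) : ℝ :=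
  ∑ j, b k j * projFst (ν k) (ν j) x + ∑ i, b i k * projSnd (ν i) (ν k) x

/-- The degenerate remainder in the Hoeffding decomposition of `∑ b i j 𝟙(X i < X j)`. -/
def hoeffdingRemainder (b : Fin n → Fin n → ℝ) (ν : Fin n → Measure ℝ) (x : Fin n → ℝ) : ℝ :=
  ∑ p : Fin n × Fin n, b p.1 p.2 * degPart (ν p.1) (ν p.2) (x p.1) (x p.2)

theorem hoeffding_decomposition (b : Fin n → Fin n → ℝ) (ν : Fin n → Measure ℝ) (x : Fin n → ℝ) :
    ∑ i, ∑ j, b i j * ltInd (x i) (x j) = ∑ i, ∑ j, b i j * ltProb (ν i) (ν j)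
      + (∑ k, hajekTerm b ν k (x k) + hoeffdingRemainder b ν x) := by
  unfold hajekTerm hoeffdingRemainder
  rw [Finset.sum_add_distrib,
    Finset.sum_comm (f := fun k i => b i k * projSnd (ν i) (ν k) (x k)), Fintype.sum_prod_type]
  simp only [← Finset.sum_add_distrib]
  refine Finset.sum_congr rfl fun i _ => Finset.sum_congr rfl fun j _ => ?_
  unfold degPart
  ring

variable (b : Fin n → Fin n → ℝ) (ν : Fin n → Measure ℝ) [∀ i, IsProbabilityMeasure (ν i)]

theorem measurable_hajekTerm (k : Fin n) : Measurable (hajekTerm b ν k) := by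
  unfold hajekTerm
  fun_prop

theorem measurable_hoeffdingRemainder : Measurable (hoeffdingRemainder b ν) := by
  unfold hoeffdingRemainder
  refine Finset.measurable_fun_sum _ fun p _ => Measurable.const_mul ?_ _
  exact measurable_degPart_comp _ _ (measurable_pi_apply p.1) (measurable_pi_apply p.2)

theorem abs_hajekTerm_le (k : Fin n) (x : ℝ) :
    |hajekTerm b ν k x| ≤ ∑ j, |b k j| + ∑ i, |b i k| := by
  unfold hajekTerm
  refine (abs_add_le _ _).trans (add_le_add ?_ ?_) <;>
  · refine (Finset.abs_sum_le_sum_abs _ _).trans (Finset.sum_le_sum fun j _ => ?_)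
    rw [abs_mul]
    refine mul_le_of_le_one_right (abs_nonneg _) ?_
    first | exact abs_projFst_le _ _ _ | exact abs_projSnd_le _ _ _

theorem integral_hajekTerm (k : Fin n) : ∫ x, hajekTerm b ν k x ∂(ν k) = 0 := by
  unfold hajekTerm
  have i1 : ∀ j, Integrable (fun x => b k j * projFst (ν k) (ν j) x) (ν k) := fun j =>
    (integrable_projFst _ _).const_mul _
  have i2 : ∀ i, Integrable (fun x => b i k * projSnd (ν i) (ν k) x) (ν k) := fun i =>
    (integrable_projSnd _ _).const_mul _
  rw [integral_add (integrable_finsetSum _ fun j _ => i1 j)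
    (integrable_finsetSum _ fun j _ => i2 j), integral_finsetSum _ fun j _ => i1 j,
    integral_finsetSum _ fun j _ => i2 j]
  simp [integral_const_mul, integral_projFst, integral_projSnd]

theorem abs_hoeffdingRemainder_le (x : Fin n → ℝ) :
    |hoeffdingRemainder b ν x| ≤ ∑ p : Fin n × Fin n, |b p.1 p.2| * 2 := by
  unfold hoeffdingRemainder
  refine (Finset.abs_sum_le_sum_abs _ _).trans (Finset.sum_le_sum fun p _ => ?_)
  rw [abs_mul]
  exact mul_le_mul_of_nonneg_left (abs_degPart_le _ _ _ _) (abs_nonneg _)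

variable {b}

theorem integral_mul_hoeffdingRemainder_eq_zero (hX : ∀ i, Measurable (X i))
    (hind : iIndepFun X μ) (hb : ∀ i j, b i j ≠ 0 → j < i)
    {G : (Fin n → ℝ) → ℝ} (hG : Measurable G) {C : ℝ} (hC : ∀ x, |G x| ≤ C)
    (hGl : ∀ i j, i ≠ j → ∃ l, (l = i ∨ l = j) ∧ ∀ x t, G (Function.update x l t) = G x) :
    ∫ ω, G (fun k => X k ω) * hoeffdingRemainder b (fun i => μ.map (X i)) (fun k => X k ω) ∂μ
      = 0 := by
  have hp : ∀ k, IsProbabilityMeasure (μ.map (X k)) := fun k =>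
    Measure.isProbabilityMeasure_map (hX k).aemeasurable
  have hXX : Measurable fun ω k => X k ω := measurable_pi_iff.2 hX
  simp only [hoeffdingRemainder, Finset.mul_sum]
  have hint : ∀ p : Fin n × Fin n, Integrable (fun ω => G (fun k => X k ω) *
      (b p.1 p.2 * degPart (μ.map (X p.1)) (μ.map (X p.2)) (X p.1 ω) (X p.2 ω))) μ := by
    intro p
    refine Integrable.of_bound (C := C * (|b p.1 p.2| * 2)) ?_ (ae_of_all _ fun ω => ?_)
    · exact ((hG.comp hXX).mul ((measurable_degPart_comp _ _ (hX p.1) (hX p.2)).const_mul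
        _)).aestronglyMeasurable
    · rw [Real.norm_eq_abs, abs_mul, abs_mul]
      exact mul_le_mul (hC _) (mul_le_mul_of_nonneg_left (abs_degPart_le _ _ _ _) (abs_nonneg _))
        (by positivity) ((abs_nonneg _).trans (hC fun k => X k ω))
  rw [integral_finsetSum _ fun p _ => hint p]
  refine Finset.sum_eq_zero fun p _ => ?_
  by_cases hbp : b p.1 p.2 = 0
  · simp [hbp]
  have hne : p.1 ≠ p.2 := (hb _ _ hbp).ne'
  obtain ⟨l, hl, hGl'⟩ := hGl _ _ hne
  have := integral_mul_degPart_eq_zero hX hind hG hC hne hl hGl'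
  simp only [mul_left_comm _ (b p.1 p.2)]
  rw [integral_const_mul, this, mul_zero]

/-- Expanding the square, the cross terms vanish and each diagonal term is at most `2² = 4` times
the squared weight. Triangularity matters: the pairs `(i, j)` and `(j, i)` share both coordinates
and need not be orthogonal. -/
theorem integral_hoeffdingRemainder_sq_le (hX : ∀ i, Measurable (X i))
    (hind : iIndepFun X μ) (hb : ∀ i j, b i j ≠ 0 → j < i) :
    ∫ ω, hoeffdingRemainder b (fun i => μ.map (X i)) (fun k => X k ω) ^ 2 ∂μ
      ≤ 4 * ∑ i, ∑ j, b i j ^ 2 := by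
  have hp : ∀ k, IsProbabilityMeasure (μ.map (X k)) := fun k =>
    Measure.isProbabilityMeasure_map (hX k).aemeasurable
  set r : Fin n × Fin n → (Fin n → ℝ) → ℝ := fun p x =>
    degPart (μ.map (X p.1)) (μ.map (X p.2)) (x p.1) (x p.2) with hr
  have hrm : ∀ p, Measurable (r p) := fun p =>
    measurable_degPart_comp _ _ (measurable_pi_apply p.1) (measurable_pi_apply p.2)
  have hrb : ∀ p x, |r p x| ≤ 2 := fun p x => abs_degPart_le _ _ _ _
  have hXX : Measurable fun ω k => X k ω := measurable_pi_iff.2 hX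
  have e : ∀ ω, hoeffdingRemainder b (fun i => μ.map (X i)) (fun k => X k ω) ^ 2
      = ∑ p : Fin n × Fin n, ∑ q : Fin n × Fin n, b p.1 p.2 * b q.1 q.2 *
        (r q (fun k => X k ω) * r p (fun k => X k ω)) := by
    intro ω
    rw [sq, hoeffdingRemainder, Finset.sum_mul_sum]
    refine Finset.sum_congr rfl fun p _ => Finset.sum_congr rfl fun q _ => ?_
    simp only [hr]; ring
  have hint : ∀ p q : Fin n × Fin n, Integrable (fun ω => b p.1 p.2 * b q.1 q.2 *
        (r q (fun k => X k ω) * r p (fun k => X k ω))) μ := by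
    intro p q
    refine Integrable.const_mul (Integrable.of_bound (C := 2 * 2)
      (((hrm q).comp hXX).mul ((hrm p).comp hXX)).aestronglyMeasurable
      (ae_of_all _ fun ω => ?_)) _
    change ‖r q (fun k => X k ω) * r p (fun k => X k ω)‖ ≤ 2 * 2
    rw [Real.norm_eq_abs, abs_mul]
    exact mul_le_mul (hrb q fun k => X k ω) (hrb p fun k => X k ω) (abs_nonneg _) zero_le_two
  simp only [e]
  rw [integral_finsetSum _ fun p _ => integrable_finsetSum _ fun q _ => hint p q]
  simp only [integral_finsetSum _ fun q _ => hint _ q]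
  rw [← Fintype.sum_prod_type (f := fun p : Fin n × Fin n => b p.1 p.2 ^ 2), Finset.mul_sum]
  refine Finset.sum_le_sum fun p _ => ?_
  rw [Finset.sum_eq_single p]
  · rw [integral_const_mul]
    have : ∫ ω, r p (fun k => X k ω) * r p (fun k => X k ω) ∂μ ≤ 4 := by
      calc _ ≤ ∫ _, (4 : ℝ) ∂μ := by
            refine integral_mono_of_nonneg (ae_of_all _ fun ω => mul_self_nonneg _)
              (integrable_const _) (ae_of_all _ fun ω => ?_)
            have := abs_le.1 (hrb p (fun k => X k ω))
            simp only []
            nlinarith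
        _ = 4 := by simp
    nlinarith [mul_self_nonneg (b p.1 p.2)]
  · intro q _ hqp
    rw [integral_const_mul]
    by_cases hbp : b p.1 p.2 = 0
    · simp [hbp]
    by_cases hbq : b q.1 q.2 = 0
    · simp [hbq]
    have h1 := hb _ _ hbp
    have h2 := hb _ _ hbq
    -- Two distinct decreasing pairs cannot have the same coordinates, so `p` has one that `q`
    -- lacks.
    obtain ⟨l, hl, hl1, hl2⟩ : ∃ l, (l = p.1 ∨ l = p.2) ∧ l ≠ q.1 ∧ l ≠ q.2 := by
      by_contra! hcon
      have c1 := hcon p.1 (Or.inl rfl)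
      have c2 := hcon p.2 (Or.inr rfl)
      by_cases d1 : p.1 = q.1
      · by_cases d2 : p.2 = q.1
        · exact absurd (d1.trans d2.symm) h1.ne'
        · exact hqp (Prod.ext d1.symm (c2 d2).symm)
      · have d3 := c1 d1
        by_cases d2 : p.2 = q.1
        · rw [d2, d3] at h1; exact absurd (h1.trans h2) (lt_irrefl _)
        · exact absurd (d3.trans (c2 d2).symm) h1.ne'
    have := integral_mul_degPart_eq_zero hX hind (hrm q) (hrb q) h1.ne' hl (fun x t => by
      simp only [hr, Function.update_of_ne hl1.symm, Function.update_of_ne hl2.symm])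
    simp only [hr] at this ⊢
    rw [this, mul_zero]
  · simp

/-! ### Conditional probabilities as Hájek projections -/

/-- The defining identity of the conditional expectation given `X i`, tested on `X i ∈ B`; the case
`B = univ` computes the unconditional probability. -/
theorem integral_indicator_mul_ltInd_sub (hX : ∀ i, Measurable (X i)) (hind : iIndepFun X μ)
    {i j : Fin n} (hij : j ≠ i) {B : Set ℝ} (hB : MeasurableSet B) :
    ∫ ω, B.indicator 1 (X i ω) * (ltInd (X i ω) (X j ω) - (μ.map (X j)).real (Set.Ioi (X i ω))) ∂μ
      = 0 := by
  have hp : ∀ k, IsProbabilityMeasure (μ.map (X k)) := fun k =>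
    Measure.isProbabilityMeasure_map (hX k).aemeasurable
  have hm1 : Measurable (B.indicator (1 : ℝ → ℝ)) := measurable_one.indicator hB
  refine integral_comp_eq_zero_of_integral_update_eq_zero hX hind
    (F := fun x => B.indicator 1 (x i) * (ltInd (x i) (x j) - (μ.map (X j)).real (Set.Ioi (x i))))
    (C := 1) ?_ (fun x => ?_) j fun x => ?_
  · have m1 : Measurable fun x : Fin n → ℝ => ltInd (x i) (x j) :=
      measurable_ltInd_comp (measurable_pi_apply i) (measurable_pi_apply j)
    have m2 : Measurable fun x : Fin n → ℝ => (μ.map (X j)).real (Set.Ioi (x i)) :=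
      (measurable_real_Ioi _).comp (measurable_pi_apply i)
    exact (hm1.comp (measurable_pi_apply i)).mul (m1.sub m2)
  · have h4 : 0 ≤ (μ.map (X j)).real (Set.Ioi (x i)) := measureReal_nonneg
    have h5 : (μ.map (X j)).real (Set.Ioi (x i)) ≤ 1 := measureReal_le_one
    have h6 := ltInd_mem (x i) (x j)
    have h7 : |ltInd (x i) (x j) - (μ.map (X j)).real (Set.Ioi (x i))| ≤ 1 := by
      rw [abs_le]; constructor <;> linarith
    by_cases hx : x i ∈ B <;> simp [hx, h7]
  · simp only [Function.update_of_ne hij.symm, Function.update_self]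
    rw [integral_const_mul, integral_sub (integrable_ltInd_right _ _) (integrable_const _),
      integral_ltInd_right]
    simp

theorem measureReal_lt_eq_ltProb (hX : ∀ i, Measurable (X i)) (hind : iIndepFun X μ)
    {i j : Fin n} (hij : j ≠ i) :
    μ.real {ω | X i ω < X j ω} = ltProb (μ.map (X i)) (μ.map (X j)) := by
  have hp : ∀ k, IsProbabilityMeasure (μ.map (X k)) := fun k =>
    Measure.isProbabilityMeasure_map (hX k).aemeasurable
  have h := integral_indicator_mul_ltInd_sub hX hind hij MeasurableSet.univ
  have hs : MeasurableSet {ω | X i ω < X j ω} := measurableSet_lt (hX i) (hX j)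
  have i1 : Integrable (fun ω => ltInd (X i ω) (X j ω)) μ :=
    Integrable.of_bound (C := 1)
      (measurable_ltInd_comp (hX i) (hX j)).aestronglyMeasurable (ae_of_all _ fun ω => by
        rw [Real.norm_eq_abs, abs_of_nonneg (ltInd_mem _ _).1]; exact (ltInd_mem _ _).2)
  have i2 : Integrable (fun ω => (μ.map (X j)).real (Set.Ioi (X i ω))) μ :=
    (integrable_map_measure (measurable_real_Ioi _).aestronglyMeasurable (hX i).aemeasurable).1
      (integrable_real_Ioi (μ.map (X i)) (μ.map (X j)))
  simp only [Set.indicator_univ, Pi.one_apply, one_mul] at h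
  rw [integral_sub i1 i2] at h
  rw [ltProb, integral_map (hX i).aemeasurable (measurable_real_Ioi _).aestronglyMeasurable,
    ← integral_indicator_one hs, ← sub_eq_zero]
  exact h

theorem centeredCondProb_ae_eq (hX : ∀ i, Measurable (X i)) (hind : iIndepFun X μ)
    {i j : Fin n} (hij : j ≠ i) :
    centeredCondProb μ X i j =ᵐ[μ] fun ω => projFst (μ.map (X i)) (μ.map (X j)) (X i ω) := by
  have hp : ∀ k, IsProbabilityMeasure (μ.map (X k)) := fun k =>
    Measure.isProbabilityMeasure_map (hX k).aemeasurable
  have hs : MeasurableSet {ω | X i ω < X j ω} := measurableSet_lt (hX i) (hX j)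
  have hm := (hX i).comap_le
  have i1 : Integrable ({ω | X i ω < X j ω}.indicator (fun _ => (1 : ℝ))) μ :=
    (integrable_const _).indicator hs
  have i2 : Integrable (fun ω => (μ.map (X j)).real (Set.Ioi (X i ω))) μ :=
    (integrable_map_measure (measurable_real_Ioi _).aestronglyMeasurable (hX i).aemeasurable).1
      (integrable_real_Ioi (μ.map (X i)) (μ.map (X j)))
  have key : (fun ω => (μ.map (X j)).real (Set.Ioi (X i ω))) =ᵐ[μ]
      μ⟦{ω' | X i ω' < X j ω'} | MeasurableSpace.comap (X i) inferInstance⟧ := by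
    refine ae_eq_condExp_of_forall_setIntegral_eq hm i1 (fun _ _ _ => i2.integrableOn) ?_ ?_
    · rintro s ⟨B, hB, rfl⟩ -
      have h := integral_indicator_mul_ltInd_sub hX hind hij hB
      have hBm := hX i hB
      rw [← integral_indicator hBm, ← integral_indicator hBm, eq_comm, ← sub_eq_zero,
        ← integral_sub (i1.indicator hBm) (i2.indicator hBm), ← h]
      refine integral_congr_ae (ae_of_all _ fun ω => ?_)
      by_cases hω : X i ω ∈ B <;> simp [hω, ltInd, Set.indicator]
    · refine StronglyMeasurable.aestronglyMeasurable (Measurable.stronglyMeasurable ?_)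
      exact (measurable_real_Ioi (μ.map (X j))).comp (comap_measurable (X i))
  filter_upwards [key] with ω hω
  rw [centeredCondProb, ← hω, measureReal_lt_eq_ltProb hX hind hij, projFst]

end
end

/-! ### Lower triangular weights: upper bounds and the variance lower bound -/

noncomputable section

/-- The strictly lower triangular weight matrix with entries `c * u i` in row `i`. -/
def lowerWeight {n : ℕ} (c : ℝ) (u : Fin n → ℝ) (i j : Fin n) : ℝ := if j < i then c * u i else 0

section
variable {n : ℕ} {c : ℝ} {u : Fin n → ℝ}

theorem lt_of_lowerWeight_ne_zero (i j : Fin n) (h : lowerWeight c u i j ≠ 0) : j < i := by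
  by_contra hji
  exact h (if_neg hji)

theorem sum_ite_lt_const (k : Fin n) (a : ℝ) : ∑ j : Fin n, (if j < k then a else 0) = k * a := by
  rw [← Finset.sum_filter, Finset.sum_const, Finset.filter_gt_eq_Iio, Fin.card_Iio, nsmul_eq_mul]

theorem sum_ite_gt_const (k : Fin n) (a : ℝ) :
    ∑ i : Fin n, (if k < i then a else 0) = ((n : ℝ) - 1 - k) * a := by
  have hk := k.isLt
  rw [← Finset.sum_filter, Finset.sum_const, Finset.filter_lt_eq_Ioi, Fin.card_Ioi, nsmul_eq_mul,
    Nat.cast_sub (by omega), Nat.cast_sub (by omega), Nat.cast_one]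

/-- Row `k` has `k` equal entries, of total `c k u k ≤ c n`; a column is dominated by `c ∑ u i ≤ c n
L`. -/
theorem sum_abs_lowerWeight_le (hc : 0 ≤ c) (hu : ∀ i, 0 ≤ u i) {L : ℝ}
    (hun : ∀ i : Fin n, i * u i ≤ n) (huL : ∑ i, u i ≤ n * L) (k : Fin n) :
    ∑ j, |lowerWeight c u k j| + ∑ i, |lowerWeight c u i k| ≤ c * n * (1 + L) := by
  have h1 : ∑ j, |lowerWeight c u k j| ≤ c * n := by
    calc ∑ j, |lowerWeight c u k j| = ∑ j : Fin n, if j < k then c * u k else 0 := by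
          refine Finset.sum_congr rfl fun j _ => ?_
          unfold lowerWeight
          split_ifs
          · exact abs_of_nonneg (mul_nonneg hc (hu k))
          · simp
      _ = c * (k * u k) := by rw [sum_ite_lt_const]; ring
      _ ≤ c * n := by gcongr; exact hun k
  have h2 : ∑ i, |lowerWeight c u i k| ≤ c * (n * L) := by
    calc ∑ i, |lowerWeight c u i k| ≤ ∑ i, c * u i := by
          refine Finset.sum_le_sum fun i _ => ?_
          unfold lowerWeight
          split_ifs
          · exact (abs_of_nonneg (mul_nonneg hc (hu i))).le
          · simpa using mul_nonneg hc (hu i)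
      _ = c * ∑ i, u i := by rw [Finset.mul_sum]
      _ ≤ c * (n * L) := by gcongr
  linarith

theorem sum_lowerWeight_sq_le (hu : ∀ i, 0 ≤ u i) {L : ℝ}
    (hun : ∀ i : Fin n, i * u i ≤ n) (huL : ∑ i, u i ≤ n * L) :
    ∑ i, ∑ j, lowerWeight c u i j ^ 2 ≤ c ^ 2 * n ^ 2 * L := by
  calc ∑ i, ∑ j, lowerWeight c u i j ^ 2 = ∑ i, c ^ 2 * ((i * u i) * u i) := by
        refine Finset.sum_congr rfl fun i _ => ?_
        have : ∀ j, lowerWeight c u i j ^ 2 = if j < i then (c * u i) ^ 2 else 0 := fun j => by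
          unfold lowerWeight; split_ifs <;> simp
        simp only [this]
        rw [sum_ite_lt_const]; ring
    _ ≤ ∑ i, c ^ 2 * (n * u i) := by
        refine Finset.sum_le_sum fun i _ => ?_
        have := mul_le_mul_of_nonneg_right (hun i) (hu i)
        gcongr
    _ = c ^ 2 * n * ∑ i, u i := by
        rw [Finset.mul_sum]; exact Finset.sum_congr rfl fun i _ => by ring
    _ ≤ c ^ 2 * n * (n * L) := by gcongr
    _ = _ := by ring

variable (ν : Fin n → Measure ℝ) [∀ i, IsProbabilityMeasure (ν i)]

/-- For indices close to `n`, the first-coordinate projections dominate the Hájek term. -/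
theorem le_abs_hajekTerm (hc : 0 ≤ c) (hu : ∀ i, 0 ≤ u i) (hn : 3 ≤ n)
    (hun : ∀ i : Fin n, (n : ℝ) / 2 ≤ i → (n : ℝ) / 2 ≤ i * u i ∧ u i ≤ 2)
    {δ : ℝ} (hδ0 : 0 < δ) (hδ1 : δ < 1) {k : Fin n} (hk : (n : ℝ) - 1 - k ≤ δ * n / 8) {x : ℝ}
    (hx : (∀ j, j ≠ k → δ ≤ projFst (ν k) (ν j) x) ∨
      (∀ j, j ≠ k → projFst (ν k) (ν j) x ≤ -δ)) :
    c * δ * n / 4 ≤ |hajekTerm (lowerWeight c u) ν k x| := by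
  have hn' : (3 : ℝ) ≤ n := by exact_mod_cast hn
  -- Since `δ < 1`, `k ≥ 7n/8 - 1`, which is at least `n/2` for `n ≥ 3`.
  have hkn : (n : ℝ) / 2 ≤ k := by nlinarith
  -- Column `k` has at most `δ n / 8` nonzero entries, each at most `2 c`; this is half of the row
  -- bound `c δ n / 2` below.
  have h2 : |∑ i, lowerWeight c u i k * projSnd (ν i) (ν k) x| ≤ c * δ * n / 4 := by
    calc _ ≤ ∑ i : Fin n, if k < i then c * 2 else 0 := by
          refine (Finset.abs_sum_le_sum_abs _ _).trans (Finset.sum_le_sum fun i _ => ?_)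
          unfold lowerWeight
          split_ifs with h
          · have hki : (k : ℝ) ≤ i := by exact_mod_cast h.le
            have hui := (hun i (hkn.trans hki)).2
            rw [abs_mul, abs_of_nonneg (mul_nonneg hc (hu i))]
            calc c * u i * |projSnd (ν i) (ν k) x| ≤ c * u i * 1 := by
                  gcongr
                  · exact mul_nonneg hc (hu i)
                  · exact abs_projSnd_le _ _ _
              _ ≤ c * 2 := by rw [mul_one]; gcongr
          · simp
      _ = ((n : ℝ) - 1 - k) * (c * 2) := sum_ite_gt_const k _
      _ ≤ δ * n / 8 * (c * 2) := by gcongr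
      _ = _ := by ring
  have h3 : c * δ * n / 2 ≤ k * (c * u k * δ) := by
    have := mul_le_mul_of_nonneg_left (hun k hkn).1 (mul_nonneg hc hδ0.le)
    calc c * δ * n / 2 = c * δ * (n / 2) := by ring
      _ ≤ _ := this
      _ = _ := by ring
  have hcu : 0 ≤ c * u k := mul_nonneg hc (hu k)
  have h2' := abs_le.1 h2
  unfold hajekTerm
  rcases hx with hx | hx
  · have h1 : k * (c * u k * δ) ≤ ∑ j, lowerWeight c u k j * projFst (ν k) (ν j) x := by
      rw [← sum_ite_lt_const]
      refine Finset.sum_le_sum fun j _ => ?_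
      unfold lowerWeight
      split_ifs with h
      · exact mul_le_mul_of_nonneg_left (hx j h.ne) hcu
      · simp
    refine le_trans ?_ (le_abs_self _)
    linarith [h2'.1]
  · have h1 : ∑ j, lowerWeight c u k j * projFst (ν k) (ν j) x ≤ k * (c * u k * -δ) := by
      rw [← sum_ite_lt_const]
      refine Finset.sum_le_sum fun j _ => ?_
      unfold lowerWeight
      split_ifs with h
      · exact mul_le_mul_of_nonneg_left (hx j h.ne) hcu
      · simp
    refine le_trans ?_ (neg_le_abs _)
    linarith [h2'.2]

end

section
variable {Ω : Type*} [MeasurableSpace Ω] {μ : Measure Ω} [IsProbabilityMeasure μ]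

/-- Markov's inequality for `Y²`; the set `s` need not be measurable. -/
theorem mul_sq_le_integral_sq {Y : Ω → ℝ} (hY : MemLp Y 2 μ) {s : Set Ω} {p T : ℝ} (hT : 0 ≤ T)
    (hs : p ≤ μ.real s) (h : ∀ᵐ ω ∂μ, ω ∈ s → T ≤ |Y ω|) :
    p * T ^ 2 ≤ ∫ ω, Y ω ^ 2 ∂μ := by
  have h1 : μ.real s ≤ μ.real {ω | T ^ 2 ≤ Y ω ^ 2} := by
    refine ENNReal.toReal_mono (measure_ne_top _ _) (measure_mono_ae ?_)
    filter_upwards [h] with ω hω hωs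
    change T ^ 2 ≤ Y ω ^ 2
    rw [← sq_abs (Y ω)]
    exact pow_le_pow_left₀ hT (hω hωs) 2
  have h2 := mul_meas_ge_le_integral_of_nonneg (μ := μ) (f := fun ω => Y ω ^ 2)
    (ae_of_all _ fun ω => sq_nonneg _) hY.integrable_sq (T ^ 2)
  calc p * T ^ 2 ≤ μ.real {ω | T ^ 2 ≤ Y ω ^ 2} * T ^ 2 := by gcongr; exact hs.trans h1
    _ = T ^ 2 * μ.real {ω | T ^ 2 ≤ Y ω ^ 2} := mul_comm _ _
    _ ≤ _ := h2

variable {n : ℕ} {X : Fin n → Ω → ℝ} {c : ℝ} {u : Fin n → ℝ}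

theorem le_sum_integral_hajekTerm_sq (hX : ∀ i, Measurable (X i)) (hind : iIndepFun X μ)
    (hc : 0 ≤ c) (hu : ∀ i, 0 ≤ u i) (hn : 3 ≤ n)
    (hun : ∀ i : Fin n, (n : ℝ) / 2 ≤ i → (n : ℝ) / 2 ≤ i * u i ∧ u i ≤ 2)
    {δ p : ℝ} (hδ0 : 0 < δ) (hδ1 : δ < 1) (hp0 : 0 < p)
    (hdev : ∀ i : Fin n,
      p ≤ μ.real {ω | ∀ j, j ≠ i → centeredCondProb μ X i j ω ∈ Set.Icc δ 1} ∨
      p ≤ μ.real {ω | ∀ j, j ≠ i → centeredCondProb μ X i j ω ∈ Set.Icc (-1) (-δ)}) :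
    δ ^ 3 * p * c ^ 2 * n ^ 3 / 128
      ≤ ∑ k, ∫ ω, hajekTerm (lowerWeight c u) (fun i => μ.map (X i)) k (X k ω) ^ 2 ∂μ := by
  have hp : ∀ k, IsProbabilityMeasure (μ.map (X k)) := fun k =>
    Measure.isProbabilityMeasure_map (hX k).aemeasurable
  have hn' : (3 : ℝ) ≤ n := by exact_mod_cast hn
  -- The number of indices with `n - 1 - k ≤ δ n / 8`. The extra one counts `k = n - 1`, and makes
  -- `m ≥ δ n / 8` despite the floor.
  set m := ⌊δ * n / 8⌋₊ + 1 with hm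
  have hfl : (⌊δ * n / 8⌋₊ : ℝ) ≤ δ * n / 8 := Nat.floor_le (by positivity)
  have hmn : m ≤ n := by
    have : (⌊δ * n / 8⌋₊ : ℝ) < n := by nlinarith
    have : ⌊δ * n / 8⌋₊ < n := by exact_mod_cast this
    omega
  have hmlow : δ * n / 8 ≤ m := by
    have := Nat.lt_floor_add_one (δ * n / 8)
    rw [hm]; push_cast; exact this.le
  set T := c * δ * n / 4 with hT
  have hT0 : 0 ≤ T := by positivity
  have hterm : ∀ k : Fin n, (n : ℝ) - 1 - k ≤ δ * n / 8 → p * T ^ 2 ≤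
      ∫ ω, hajekTerm (lowerWeight c u) (fun i => μ.map (X i)) k (X k ω) ^ 2 ∂μ := by
    intro k hk
    have hL : MemLp (fun ω => hajekTerm (lowerWeight c u) (fun i => μ.map (X i)) k (X k ω)) 2 μ :=
      MemLp.of_bound ((measurable_hajekTerm _ _ k).comp (hX k)).aestronglyMeasurable _
        (ae_of_all _ fun ω => abs_hajekTerm_le _ _ k _)
    have hae : ∀ᵐ ω ∂μ, ∀ j, j ≠ k → centeredCondProb μ X k j ω
        = projFst (μ.map (X k)) (μ.map (X j)) (X k ω) := by
      rw [ae_all_iff]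
      intro j
      by_cases hj : j = k
      · exact ae_of_all _ fun ω h => absurd hj h
      · filter_upwards [centeredCondProb_ae_eq hX hind hj] with ω hω _ using hω
    rcases hdev k with h | h
    · refine mul_sq_le_integral_sq hL hT0 h ?_
      filter_upwards [hae] with ω hω hωs
      refine le_abs_hajekTerm _ hc hu hn hun hδ0 hδ1 hk (Or.inl fun j hj => ?_)
      rw [← hω j hj]; exact (hωs j hj).1
    · refine mul_sq_le_integral_sq hL hT0 h ?_
      filter_upwards [hae] with ω hω hωs
      refine le_abs_hajekTerm _ hc hu hn hun hδ0 hδ1 hk (Or.inr fun j hj => ?_)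
      rw [← hω j hj]; exact (hωs j hj).2
  have hlt : n - m < n := by omega
  calc δ ^ 3 * p * c ^ 2 * n ^ 3 / 128 = (δ * n / 8) * (p * T ^ 2) := by rw [hT]; ring
    _ ≤ m * (p * T ^ 2) := by gcongr
    _ = ∑ _k ∈ Finset.Ici (⟨n - m, hlt⟩ : Fin n), p * T ^ 2 := by
        rw [Finset.sum_const, Fin.card_Ici, nsmul_eq_mul]
        congr 2
        simp only []
        omega
    _ ≤ ∑ k ∈ Finset.Ici (⟨n - m, hlt⟩ : Fin n),
          ∫ ω, hajekTerm (lowerWeight c u) (fun i => μ.map (X i)) k (X k ω) ^ 2 ∂μ := by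
        refine Finset.sum_le_sum fun k hk => hterm k ?_
        have h1 : n - m ≤ (k : ℕ) := Fin.le_def.1 (Finset.mem_Ici.1 hk)
        have h2 : n ≤ (k : ℕ) + (⌊δ * n / 8⌋₊ + 1) := by omega
        have h3 : (n : ℝ) ≤ k + (⌊δ * n / 8⌋₊ + 1) := by exact_mod_cast h2
        linarith
    _ ≤ _ := Finset.sum_le_sum_of_subset_of_nonneg (Finset.subset_univ _)
        fun k _ _ => integral_nonneg fun ω => sq_nonneg _

end

/-- Asymptotic normality for weights `c * u i * 𝟙(j < i)`, where `u` is of order one near `n`. -/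
theorem asymptoticallyNormal_lowerWeight {Ω : ℕ → Type*} [∀ n, MeasurableSpace (Ω n)]
    (μ : ∀ n, Measure (Ω n)) [∀ n, IsProbabilityMeasure (μ n)]
    (X : ∀ n, Fin n → Ω n → ℝ)
    (hX : ∀ n i, Measurable (X n i)) (hind : ∀ n, iIndepFun (X n) (μ n))
    (δ p : ℕ → ℝ) (hδ : ∀ n, 1 ≤ n → δ n ∈ Set.Ioo (0 : ℝ) 1)
    (hp : ∀ n, 1 ≤ n → p n ∈ Set.Ioo (0 : ℝ) 1)
    (hdev : ∀ᶠ n in atTop, ∀ i : Fin n,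
      p n ≤ (μ n).real
          {ω | ∀ j, j ≠ i → centeredCondProb (μ n) (X n) i j ω ∈ Set.Icc (δ n) 1} ∨
      p n ≤ (μ n).real
          {ω | ∀ j, j ≠ i → centeredCondProb (μ n) (X n) i j ω ∈ Set.Icc (-1) (-δ n)})
    {c L : ℕ → ℝ} {u : ∀ n, Fin n → ℝ} (hc : ∀ᶠ n in atTop, 0 < c n) (hu : ∀ n i, 0 ≤ u n i)
    (hun : ∀ n (i : Fin n), i * u n i ≤ n) (huL : ∀ᶠ n in atTop, ∑ i, u n i ≤ n * L n)
    (hL : ∀ᶠ n in atTop, 1 ≤ L n)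
    (huh : ∀ n (i : Fin n), (n : ℝ) / 2 ≤ i → (n : ℝ) / 2 ≤ i * u n i ∧ u n i ≤ 2) {C : ℝ}
    (hC : ∀ᶠ n : ℕ in atTop, (n : ℝ) ^ (-(1 / 3) : ℝ) * L n ^ 2 ≤ C * (δ n ^ 3 * p n)) :
    AsymptoticallyNormal μ
      (fun n ω => ∑ i, ∑ j, lowerWeight (c n) (u n) i j * ltInd (X n i ω) (X n j ω)) := by
  have hpm : ∀ n k, IsProbabilityMeasure ((μ n).map (X n k)) := fun n k =>
    Measure.isProbabilityMeasure_map (hX n k).aemeasurable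
  have hXX : ∀ n, Measurable fun ω k => X n k ω := fun n => measurable_pi_iff.2 (hX n)
  have hn3 : ∀ᶠ n : ℕ in atTop, 3 ≤ n := eventually_ge_atTop 3
  have hlim : Tendsto (fun n : ℕ => 512 * C * (n : ℝ) ^ (-(2 / 3) : ℝ)) atTop (𝓝 0) := by
    simpa using ((tendsto_rpow_neg_atTop (y := 2 / 3) (by norm_num)).comp
      tendsto_natCast_atTop_atTop).const_mul (512 * C)
  -- One bound serves both ratios: `4` covers `(1 + L)² ≤ 4 L²` for the summands and the factor `4`
  -- in the remainder's second moment, where `L ≤ L²`. Then `512 = 4 * 128`.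
  have hratio : ∀ᶠ n : ℕ in atTop, 4 * (c n ^ 2 * n ^ 2 * L n ^ 2)
      / (δ n ^ 3 * p n * c n ^ 2 * n ^ 3 / 128) ≤ 512 * C * (n : ℝ) ^ (-(2 / 3) : ℝ) := by
    filter_upwards [hC, hn3, hc] with n h1 h2 h3
    have hd := (hδ n (by omega)).1
    have hq := (hp n (by omega)).1
    have hn0 : (0 : ℝ) < n := by exact_mod_cast (by omega : 0 < n)
    have hpow : (n : ℝ) * (n : ℝ) ^ (-(2 / 3) : ℝ) * (n : ℝ) ^ (-(1 / 3) : ℝ) = 1 := by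
      rw [mul_assoc, ← Real.rpow_add hn0]
      norm_num [Real.rpow_neg_one]
      exact mul_inv_cancel₀ hn0.ne'
    have hn23 : 0 < (n : ℝ) ^ (-(2 / 3) : ℝ) := Real.rpow_pos_of_pos hn0 _
    have h4 : L n ^ 2 ≤ C * (δ n ^ 3 * p n) * (n * (n : ℝ) ^ (-(2 / 3) : ℝ)) := by
      have := mul_le_mul_of_nonneg_right h1 (mul_pos hn0 hn23).le
      calc L n ^ 2 = (n : ℝ) ^ (-(1 / 3) : ℝ) * L n ^ 2 * (n * (n : ℝ) ^ (-(2 / 3) : ℝ)) := by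
            linear_combination (-(L n ^ 2)) * hpow
        _ ≤ _ := this
    rw [div_le_iff₀ (by positivity)]
    calc 4 * (c n ^ 2 * n ^ 2 * L n ^ 2)
        ≤ 4 * (c n ^ 2 * n ^ 2 * (C * (δ n ^ 3 * p n) * (n * (n : ℝ) ^ (-(2 / 3) : ℝ)))) := by
          gcongr
      _ = _ := by ring
  refine asymptoticallyNormal_of_sum_add_remainder
    (Y := fun n k ω => hajekTerm (lowerWeight (c n) (u n)) (fun i => (μ n).map (X n i)) k (X n k ω))
    (R := fun n ω => hoeffdingRemainder (lowerWeight (c n) (u n)) (fun i => (μ n).map (X n i))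
      (fun k => X n k ω))
    (m := fun n => ∑ i, ∑ j, lowerWeight (c n) (u n) i j
      * ltProb ((μ n).map (X n i)) ((μ n).map (X n j)))
    (M := fun n => c n * n * (1 + L n)) (v := fun n => δ n ^ 3 * p n * c n ^ 2 * n ^ 3 / 128)
    (fun n k => (measurable_hajekTerm _ _ k).comp (hX n k))
    (fun n => (measurable_hoeffdingRemainder _ _).comp (hXX n))
    (fun n => (hind n).comp _ fun k => measurable_hajekTerm _ _ k)
    (fun n k => ?_) (fun n => ?_) (fun n => ?_) (fun n k => ?_)
    (fun n ω => hoeffding_decomposition _ _ _) ?_ ?_ ?_ ?_ ?_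
  · rw [← integral_map (f := hajekTerm (lowerWeight (c n) (u n)) (fun i => (μ n).map (X n i)) k)
      (hX n k).aemeasurable (measurable_hajekTerm _ _ k).aestronglyMeasurable]
    exact integral_hajekTerm _ (fun i => (μ n).map (X n i)) k
  · exact MemLp.of_bound ((measurable_hoeffdingRemainder _ _).comp (hXX n)).aestronglyMeasurable _
      (ae_of_all _ fun ω => abs_hoeffdingRemainder_le _ _ _)
  · simpa using integral_mul_hoeffdingRemainder_eq_zero (hX n) (hind n)
      (b := lowerWeight (c n) (u n)) lt_of_lowerWeight_ne_zero (G := fun _ => 1)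
      measurable_const (C := 1) (by simp) (fun i j _ => ⟨i, Or.inl rfl, by simp⟩)
  · refine integral_mul_hoeffdingRemainder_eq_zero (hX n) (hind n)
      (b := lowerWeight (c n) (u n)) lt_of_lowerWeight_ne_zero
      (G := fun x => hajekTerm (lowerWeight (c n) (u n)) (fun i => (μ n).map (X n i)) k (x k))
      ((measurable_hajekTerm _ _ k).comp (measurable_pi_apply k))
      (fun x => abs_hajekTerm_le _ _ k _) (fun i j hij => ?_)
    -- The Hájek term sees only coordinate `k`, and `i ≠ j`, so one of the two is invisible to it.
    by_cases hik : i = k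
    · exact ⟨j, Or.inr rfl, fun x t => by rw [Function.update_of_ne (hik ▸ hij)]⟩
    · exact ⟨i, Or.inl rfl, fun x t => by rw [Function.update_of_ne (Ne.symm hik)]⟩
  · filter_upwards [hc, huL] with n h1 h2 k ω
    exact (abs_hajekTerm_le _ _ k _).trans
      (sum_abs_lowerWeight_le h1.le (hu n) (hun n) h2 k)
  · filter_upwards [hc, hn3] with n h1 h2
    have hd := (hδ n (by omega)).1
    have hq := (hp n (by omega)).1
    have hn0 : (0 : ℝ) < n := by exact_mod_cast (by omega : 0 < n)
    positivity
  · filter_upwards [hc, hn3, hdev] with n h1 h2 h3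
    have hd := hδ n (by omega)
    exact le_sum_integral_hajekTerm_sq (hX n) (hind n) h1.le (hu n) h2 (huh n) hd.1 hd.2
      (hp n (by omega)).1 h3
  · refine tendsto_of_tendsto_of_tendsto_of_le_of_le' tendsto_const_nhds hlim ?_ ?_
    · filter_upwards [hn3] with n h2
      have hd := (hδ n (by omega)).1
      have hq := (hp n (by omega)).1
      positivity
    · filter_upwards [hratio, hL, hn3] with n h1 h2 h3
      have hd := (hδ n (by omega)).1
      have hq := (hp n (by omega)).1
      refine le_trans ?_ h1
      gcongr
      calc (c n * n * (1 + L n)) ^ 2 = c n ^ 2 * n ^ 2 * (1 + L n) ^ 2 := by ring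
        _ ≤ c n ^ 2 * n ^ 2 * (2 * L n) ^ 2 := by gcongr; linarith
        _ = _ := by ring
  · refine tendsto_of_tendsto_of_tendsto_of_le_of_le' tendsto_const_nhds hlim ?_ ?_
    · filter_upwards [hn3] with n h2
      have hd := (hδ n (by omega)).1
      have hq := (hp n (by omega)).1
      exact div_nonneg (integral_nonneg fun ω => sq_nonneg _) (by positivity)
    · filter_upwards [hratio, hL, hn3, huL] with n h1 h2 h3 h4
      have hd := (hδ n (by omega)).1
      have hq := (hp n (by omega)).1
      refine le_trans ?_ h1
      refine div_le_div_of_nonneg_right ?_ (by positivity)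
      refine (integral_hoeffdingRemainder_sq_le (hX n) (hind n)
        (b := lowerWeight (c n) (u n)) lt_of_lowerWeight_ne_zero).trans ?_
      have h5 := sum_lowerWeight_sq_le (c := c n) (hu n) (hun n) h4
      have h6 : L n ≤ L n ^ 2 := by nlinarith
      have h7 : c n ^ 2 * n ^ 2 * L n ≤ c n ^ 2 * n ^ 2 * L n ^ 2 := by gcongr
      linarith

/-! ### Specialisation to Kendall's tau and average precision -/

theorem weightedRankStat_ite_lt {n : ℕ} (u : Fin n → ℝ) (x : Fin n → ℝ) :
    weightedRankStat (fun i j => if j < i then u i else 0) x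
      = ∑ i, ∑ j, lowerWeight (1 / ((n : ℝ) * ((n : ℝ) - 1))) u i j * ltInd (x i) (x j) := by
  unfold weightedRankStat lowerWeight ltInd
  rw [Finset.mul_sum]
  refine Finset.sum_congr rfl fun i _ => ?_
  rw [Finset.mul_sum]
  refine Finset.sum_congr rfl fun j _ => ?_
  by_cases h : j < i
  · simp [h, h.ne]
  · simp [h]

theorem sum_fin_natCast_div_le (n : ℕ) :
    ∑ i : Fin n, (n : ℝ) / ((i : ℕ) : ℝ) ≤ n * (1 + Real.log n) := by
  rw [Fin.sum_univ_eq_sum_range (fun i : ℕ => (n : ℝ) / (i : ℝ)) n]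
  cases n with
  | zero => simp
  | succ m =>
    simp only [div_eq_mul_inv]
    -- The index `0` term is `n / 0 = 0`, harmless since that row has no entries; what remains is
    -- `n` times the harmonic number of `n - 1`.
    rw [← Finset.mul_sum, Finset.sum_range_succ']
    refine mul_le_mul_of_nonneg_left ?_ (Nat.cast_nonneg _)
    have h1 := harmonic_le_one_add_log (m + 1)
    have h2 : (harmonic (m + 1) : ℝ) = ∑ i ∈ Finset.range m, ((i + 1 : ℕ) : ℝ)⁻¹
        + ((m + 1 : ℕ) : ℝ)⁻¹ := by
      simp [harmonic, Finset.sum_range_succ]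
    have h3 : (0 : ℝ) ≤ ((m + 1 : ℕ) : ℝ)⁻¹ := by positivity
    simp only [Nat.cast_zero, inv_zero, add_zero]
    linarith

end

theorem mainTheorem6 {Ω : ℕ → Type*} [∀ n, MeasurableSpace (Ω n)]
    (μ : ∀ n, Measure (Ω n)) [∀ n, IsProbabilityMeasure (μ n)]
    (X : ∀ n, Fin n → Ω n → ℝ)
    (hX_meas : ∀ n i, Measurable (X n i))
    (hX_indep : ∀ n, iIndepFun (X n) (μ n))
    (hX_ac : ∀ n i, (μ n).map (X n i) ≪ volume)
    (δ p : ℕ → ℝ)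
    (hδ : ∀ n, 1 ≤ n → δ n ∈ Set.Ioo (0 : ℝ) 1)
    (hp : ∀ n, 1 ≤ n → p n ∈ Set.Ioo (0 : ℝ) 1)
    (hdev : ∀ᶠ n in atTop, ∀ i : Fin n,
      p n ≤ (μ n).real
          {ω | ∀ j, j ≠ i → centeredCondProb (μ n) (X n) i j ω ∈ Set.Icc (δ n) 1} ∨
      p n ≤ (μ n).real
          {ω | ∀ j, j ≠ i → centeredCondProb (μ n) (X n) i j ω ∈ Set.Icc (-1) (-δ n)}) :
    (StrictlyGtrsim (fun n => δ n ^ 3 * p n) (fun n => (n : ℝ) ^ (-(1 / 3) : ℝ)) →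
      AsymptoticallyNormal μ (fun n ω => kendallU (fun i => X n i ω))) ∧
    (StrictlyGtrsim (fun n => δ n ^ 3 * p n)
        (fun n => (n : ℝ) ^ (-(1 / 3) : ℝ) * Real.log n ^ 2) →
      AsymptoticallyNormal μ (fun n ω => apU (fun i => X n i ω))) := by

  have hcpos : ∀ᶠ n : ℕ in atTop, (0 : ℝ) < 1 / ((n : ℝ) * ((n : ℝ) - 1)) := by
    filter_upwards [eventually_ge_atTop 2] with n hn
    have hn' : (2 : ℝ) ≤ n := by exact_mod_cast hn
    exact one_div_pos.2 (mul_pos (by linarith) (by linarith))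
  have hbound : ∀ {f : ℕ → ℝ}, (∀ n, 0 ≤ f n) →
      f =O[atTop] (fun n => δ n ^ 3 * p n) →
      ∃ C, ∀ᶠ n : ℕ in atTop, f n ≤ C * (δ n ^ 3 * p n) := by
    intro f hf h
    obtain ⟨C, hC⟩ := h.bound
    refine ⟨C, ?_⟩
    filter_upwards [hC, eventually_ge_atTop 1] with n h1 h2
    have hd := (hδ n h2).1
    have hq := (hp n h2).1
    rwa [Real.norm_eq_abs, Real.norm_eq_abs, abs_of_nonneg (hf n),
      abs_of_nonneg (by positivity)] at h1
  refine ⟨fun h => ?_, fun h => ?_⟩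
  · obtain ⟨C, hC⟩ := hbound (fun n => by positivity) h.1
    have hu1 : ∀ n (i : Fin n), ((i : ℕ) : ℝ) ≤ n := fun n i => by exact_mod_cast i.isLt.le
    have := asymptoticallyNormal_lowerWeight μ X hX_meas hX_indep δ p hδ hp hdev
      (u := fun _ _ => 1) (L := fun _ => 1) hcpos (fun _ _ => zero_le_one)
      (fun n i => by simp [hu1 n i]) (Eventually.of_forall fun n => by simp)
      (Eventually.of_forall fun _ => le_rfl) (fun n i hi => ⟨by rwa [mul_one], one_le_two⟩)
      (C := C) (by simpa using hC)
    simp only [← weightedRankStat_ite_lt] at this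
    exact this
  · obtain ⟨C, hC⟩ := hbound (fun n => by positivity) h.1
    have hlog : ∀ᶠ n : ℕ in atTop, 1 ≤ Real.log n :=
      (Real.tendsto_log_atTop.comp tendsto_natCast_atTop_atTop).eventually_ge_atTop 1
    have := asymptoticallyNormal_lowerWeight μ X hX_meas hX_indep δ p hδ hp hdev
      (u := fun n i => (n : ℝ) / ((i : ℕ) : ℝ)) (L := fun n => 1 + Real.log n) hcpos
      (fun n i => by positivity) (fun n i => by
        by_cases hi : ((i : ℕ) : ℝ) = 0
        · simp [hi]
        · exact (mul_div_cancel₀ _ hi).le)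
      (Eventually.of_forall sum_fin_natCast_div_le)
      (by filter_upwards [hlog] with n hn; linarith)
      (fun n i hi => by
        have hn0 : (0 : ℝ) < n := by exact_mod_cast i.pos
        have hi0 : (0 : ℝ) < (i : ℕ) := by linarith
        rw [mul_div_cancel₀ _ hi0.ne', div_le_iff₀ hi0]
        constructor <;> linarith)
      -- The factor `4` comes from `1 + log n ≤ 2 log n`, squared.
      (C := 4 * C) (by
        filter_upwards [hC, hlog] with n h1 h2
        calc (n : ℝ) ^ (-(1 / 3) : ℝ) * (1 + Real.log n) ^ 2
            ≤ (n : ℝ) ^ (-(1 / 3) : ℝ) * (2 * Real.log n) ^ 2 := by gcongr; linarith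
          _ = 4 * ((n : ℝ) ^ (-(1 / 3) : ℝ) * Real.log n ^ 2) := by ring
          _ ≤ 4 * (C * (δ n ^ 3 * p n)) := by gcongr
          _ = _ := by ring)
    simp only [← weightedRankStat_ite_lt] at this
    exact this
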